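/- Let $n\ge 0$, $r\ge 1$, $s\ge 0$ be integers. Let $q_1,q_2$ be nonzero complex numbers in the open unit disk with either $q_1=\overline{q_2}$ or $q_1,q_2\in(0,1)$. Let $\vec u=(u_1,\dots,u_r)\in\mathbb C^r$ satisfy $|q_i|\max_\alpha|u_\alpha|<\min_\alpha|u_\alpha|$ for $i=1,2$, let $\vec p=(p_1,\dots,p_s)\in\mathbb C^s$, and let $\rho>0$ be any number with $|u_\alpha|<\rho<|q_i|^{-1}|u_\alpha|$ for all $\alpha=1,\dots,r$ and $i=1,2$. With $C_\rho=\{z\in\mathbb C:|z|=\rho\}$ put $$\mathcal Z_n(\vec u;\vec p)=\frac1{n!}\Big(\frac{1-q_1q_2}{(1-q_1)(1-q_2)}\Big)^n\int_{C_\rho^n}\prod_{j=1}^n\frac{dz_j}{2\pi i z_j}\;\prod_{j=1}^n\prod_{m=1}^s(z_j-p_m)\;\mathcal I(z_1,\dots,z_n;\vec u),$$ $$\mathcal I(z_1,\dots,z_n;\vec u)=\prod_{j=1}^n\prod_{\alpha=1}^r\frac{-u_\alpha z_j}{(z_j-u_\alpha)(q_1q_2z_j-u_\alpha)}\prod_{1\le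 j\ne k\le n}\frac{(z_j-z_k)(z_j-q_1q_2z_k)}{(z_j-q_1z_k)(z_j-q_2z_k)}.$$ A partition $Y$ is identified with its Young diagram $\{(x,y):1\le x\le l(Y),\,1\le y\le Y(x)\}$, where $l(Y)$ is the number of parts, $Y(x)=0$ for $x>l(Y)$ and $Y^T$ is the transpose. For any box $c=(x,y)$, in $Y$ or not, $a_Y(c)=Y(x)-y$ and $l_Y(c)=Y^T(y)-x$. For $c=(x,y)$ let $z^\alpha_c=u_\alpha q_1^{x-1}q_2^{y-1}$. **Theorem.** Assume that $u_\alpha u_\beta^{-1}\ne q_1^xq_2^y$ for all $\alpha\ne\beta$ and all $x,y\in\{-n,\dots,n\}$, and that $q_1^x\ne q_2^{y+1}$ and $q_1^{x+1}\ne q_2^y$ for all $x,y\in\{0,\dots,n-1\}$. For an $r$-tuple $\vec Y=(Y_1,\dots,Y_r)$ of partitions of total size $|\vec Y|=|Y_1|+\dots+|Y_r|=n$ put $$N^{\vec Y}_{\alpha,\beta}=\prod_{c\in Y_\alpha}\Big(1-\frac{u_\alpha}{u_\beta}q_1^{l_{Y_\alpha}(c)+1}q_2^{-a_{Y_\beta}(c)}\Big)\prod_{t\in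 Y_\beta}\Big(1-\frac{u_\alpha}{u_\beta}q_1^{-l_{Y_\beta}(t)}q_2^{a_{Y_\alpha}(t)+1}\Big),$$ $$M^{\vec Y}_{\alpha,\beta}=\prod_{c\in Y_\alpha}\Big(1-\frac{u_\alpha}{u_\beta}q_1^{-l_{Y_\beta}(c)}q_2^{a_{Y_\alpha}(c)+1}\Big)\prod_{t\in Y_\beta}\Big(1-\frac{u_\alpha}{u_\beta}q_1^{l_{Y_\alpha}(t)+1}q_2^{-a_{Y_\beta}(t)}\Big).$$ Then the integrand of $\mathcal Z_n(\vec u;\vec p)$ is integrable on $C_\rho^n$, all $N^{\vec Y}_{\alpha,\beta}$ and $M^{\vec Y}_{\alpha,\beta}$ with $|\vec Y|=n$ and $\alpha,\beta\in\{1,\dots,r\}$ are nonzero, and $$\mathcal Z_n(\vec u;\vec p)=\sum_{|\vec Y|=n}\frac{\prod_{\alpha=1}^r\prod_{c\in Y_\alpha}\prod_{m=1}^s(z^\alpha_c-p_m)}{\prod_{\alpha,\beta=1}^rN^{\vec Y}_{\alpha,\beta}}=\sum_{|\vec Y|=n}\frac{\prod_{\alpha=1}^r\prod_{c\in Y_\alpha}\prod_{m=1}^s(z^\alpha_c-p_m)}{\prod_{\alpha,\beta=1}^rM^{\vec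 Y}_{\alpha,\beta}}.$$ -/

import Mathlib

open scoped Real

namespace Nekrasov

/-! Partitions are Mathlib's Young diagrams in English convention. Mathlib's boxes `(i, j)` are
counted from zero: the box in row `x` and column `y` (counted from one) is `(x - 1, y - 1)`. -/

/-- Arm length `Y(x) - y` of a box, which need not belong to `Y` (so it may be negative). -/
def arm (Y : YoungDiagram) (s : ℕ × ℕ) : ℤ :=
  (Y.rowLen s.1 : ℤ) - ((s.2 : ℤ) + 1)

/-- Leg length `Yᵀ(y) - x` of a box, which need not belong to `Y` (so it may be negative). -/
def leg (Y : YoungDiagram) (s : ℕ × ℕ) : ℤ :=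
  (Y.colLen s.2 : ℤ) - ((s.1 : ℤ) + 1)

/-- There are finitely many `r`-tuples of partitions of total size `n`. -/
theorem finite_partitionTuples (r n : ℕ) :
    {Y : Fin r → YoungDiagram | ∑ α, (Y α).card = n}.Finite := by
  have hfin : {μ : YoungDiagram | μ.card ≤ n}.Finite := by
    have hinj : Function.Injective YoungDiagram.cells := fun a b h => YoungDiagram.ext h
    refine Set.Finite.of_finite_image (f := YoungDiagram.cells) ?_ hinj.injOn
    refine Set.Finite.subset
      (Finset.finite_toSet (Finset.powerset (Finset.range n ×ˢ Finset.range n))) ?_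
    rintro _ ⟨μ, hμ, rfl⟩
    have hμ' : μ.cells.card ≤ n := hμ
    rw [Finset.mem_coe, Finset.mem_powerset]
    rintro ⟨i, j⟩ hij
    have hij' : (i, j) ∈ μ := (YoungDiagram.mem_cells _).1 hij
    have h1 : i < μ.colLen j := YoungDiagram.mem_iff_lt_colLen.1 hij'
    have h2 : j < μ.rowLen i := YoungDiagram.mem_iff_lt_rowLen.1 hij'
    have h3 : μ.colLen j ≤ μ.cells.card := by
      rw [YoungDiagram.colLen_eq_card]
      exact Finset.card_le_card (Finset.filter_subset _ _)
    have h4 : μ.rowLen i ≤ μ.cells.card := by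
      rw [YoungDiagram.rowLen_eq_card]
      exact Finset.card_le_card (Finset.filter_subset _ _)
    rw [Finset.mem_product, Finset.mem_range, Finset.mem_range]
    constructor <;> dsimp only <;> omega
  refine Set.Finite.subset (Set.Finite.pi' (fun _ : Fin r => hfin)) ?_
  intro Y hY α
  have hY' : ∑ α, (Y α).card = n := hY
  have : (Y α).card ≤ ∑ β, (Y β).card :=
    Finset.single_le_sum (f := fun β => (Y β).card) (fun _ _ => Nat.zero_le _) (Finset.mem_univ α)
  exact this.trans hY'.le

/-- The finite set of `r`-tuples of partitions of total size `n`. -/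
noncomputable def partitionTuples (r n : ℕ) : Finset (Fin r → YoungDiagram) :=
  (finite_partitionTuples r n).toFinset

theorem mem_partitionTuples {r n : ℕ} {Y : Fin r → YoungDiagram} :
    Y ∈ partitionTuples r n ↔ ∑ α, (Y α).card = n := by
  simp [partitionTuples]

/-- The function `I(z₁, …, zₙ; u)`. -/
noncomputable def weight (q₁ q₂ : ℂ) {r n : ℕ} (u : Fin r → ℂ) (z : Fin n → ℂ) : ℂ :=
  (∏ j, ∏ α, (-(u α) * z j) / ((z j - u α) * (q₁ * q₂ * z j - u α))) *
    ∏ j, ∏ k ∈ Finset.univ.erase j,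
      ((z j - z k) * (z j - q₁ * q₂ * z k)) / ((z j - q₁ * z k) * (z j - q₂ * z k))

/-- The full integrand, with the factors `1 / (2πi z_j)` of the measure and the masses `p`. -/
noncomputable def integrand (q₁ q₂ : ℂ) {r s n : ℕ} (u : Fin r → ℂ) (p : Fin s → ℂ)
    (z : Fin n → ℂ) : ℂ :=
  (∏ j, 1 / (2 * (π : ℂ) * Complex.I * z j)) * (∏ j, ∏ m, (z j - p m)) * weight q₁ q₂ u z

/-- The `n`-fold contour integral `Zₙ(u; p)` over the torus of radius `ρ` about the origin. -/
noncomputable def Z (q₁ q₂ : ℂ) (ρ : ℝ) {r s : ℕ} (n : ℕ) (u : Fin r → ℂ) (p : Fin s → ℂ) : ℂ :=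
  (1 / (n.factorial : ℂ)) * ((1 - q₁ * q₂) / ((1 - q₁) * (1 - q₂))) ^ n *
    torusIntegral (integrand q₁ q₂ u p) (0 : Fin n → ℂ) (fun _ => ρ)

/-- `z^α_{x,y} = u_α q₁^(x-1) q₂^(y-1)`, for a box counted from zero. -/
noncomputable def boxPoint (q₁ q₂ : ℂ) {r : ℕ} (u : Fin r → ℂ) (α : Fin r) (s : ℕ × ℕ) : ℂ :=
  u α * q₁ ^ s.1 * q₂ ^ s.2

/-- The numerator `∏_α ∏_{s ∈ Y_α} ∏_m (z^α_s - p_m)`. -/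
noncomputable def numer (q₁ q₂ : ℂ) {r s : ℕ} (u : Fin r → ℂ) (p : Fin s → ℂ)
    (Y : Fin r → YoungDiagram) : ℂ :=
  ∏ α, ∏ c ∈ (Y α).cells, ∏ m, (boxPoint q₁ q₂ u α c - p m)

/-- The factor `N_{α,β}` of the denominator. -/
noncomputable def N (q₁ q₂ : ℂ) {r : ℕ} (u : Fin r → ℂ) (Y : Fin r → YoungDiagram)
    (α β : Fin r) : ℂ :=
  (∏ s ∈ (Y α).cells, (1 - u α / u β * q₁ ^ (leg (Y α) s + 1) * q₂ ^ (-arm (Y β) s))) *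
    ∏ t ∈ (Y β).cells, (1 - u α / u β * q₁ ^ (-leg (Y β) t) * q₂ ^ (arm (Y α) t + 1))

/-- The factor `M_{α,β}` of the denominator. -/
noncomputable def M (q₁ q₂ : ℂ) {r : ℕ} (u : Fin r → ℂ) (Y : Fin r → YoungDiagram)
    (α β : Fin r) : ℂ :=
  (∏ s ∈ (Y α).cells, (1 - u α / u β * q₁ ^ (-leg (Y β) s) * q₂ ^ (arm (Y α) s + 1))) *
    ∏ t ∈ (Y β).cells, (1 - u α / u β * q₁ ^ (leg (Y α) t + 1) * q₂ ^ (-arm (Y β) t))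

end Nekrasov

/-! The interaction is homogeneous of degree zero, so a common rotation or dilation of all variables
does not change it. The torus integral is therefore averaged over a common rotation first. The
residue theorem in that single variable sees only the poles of the one-body factor, never those of
the interaction. At such a pole one variable sits at a point χ and the others run over the circle of
radius |χ|. There the interaction with χ has nonvanishing denominators, and its zero at χ cancels
the pole that the one-body factor has there. What remains is an integral of the same shape with one
variable fewer, on the circle of radius |χ|, with the one-body factor multiplied by the interaction
with χ (`torusAvg_succ_poleFun`).

Iterating this adds boxes one at a time. In the presence of a tuple Y the one-body factor contains a
product of cross ratios over the boxes of Y, and this product telescopes (`prod_crossRatio_div`).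
Inside the current circle its only possible poles are then the addable boxes of smaller modulus
(`oneBody_eq_poleFun`). The residue at an added box, times (1 - q₁q₂) / ((1 - q₁)(1 - q₂)), is the
quotient of the products of all `N` before and after the addition (`resFun_mul_prodN`).

Boxes are added in order of decreasing modulus. If all moduli are distinct, each tuple is built in
exactly one way (`sum_addTuple`), and the choices of the variable taken at each step consume n!.
This proves the first formula in the generic case (`Z_eq_sum_of_injective`). Moduli do coincide, for
instance when |q₁| = |q₂|, so the parameters are perturbed along a curve: distinctness holds on a
dense set, and both sides are continuous (`Z_eq_sum`). The genericity assumptions keep the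
denominators nonzero (`N_ne_zero`). The formula with `M` is the one with `N` after exchanging q₁ and
q₂ and transposing all diagrams. -/

namespace Nekrasov

open MeasureTheory Filter Topology
open scoped Real

/-! ### Residue theorem on a circle by partial fractions -/

section Residues

/-- The residue theorem for a quotient with finitely many simple poles, all inside the circle. -/
theorem circleAverage_mul_div_prod_sub {ι : Type*} [DecidableEq ι] (s : Finset ι) (v : ι → ℂ)
    (H : ℂ → ℂ) {R : ℝ} (hR : 0 < R) (hv : Set.InjOn v s) (hvR : ∀ i ∈ s, ‖v i‖ < R)
    (hH : DifferentiableOn ℂ H (Metric.closedBall 0 R)) :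
    Real.circleAverage (fun ζ => ζ * H ζ / ∏ i ∈ s, (ζ - v i)) 0 R =
      ∑ i ∈ s, H (v i) / ∏ j ∈ s.erase i, (v i - v j) := by
  have habs : |R| = R := abs_of_pos hR
  have hcl : closure (Metric.ball (0 : ℂ) R) = Metric.closedBall 0 R := closure_ball _ hR.ne'
  have hHcl : DiffContOnCl ℂ H (Metric.ball 0 |R|) := by
    refine DifferentiableOn.diffContOnCl ?_
    rw [habs, hcl]
    exact hH
  -- Interpolation needs at least one node. Without poles the mean value property gives the value at
  -- 0, where the factor ζ vanishes.
  rcases s.eq_empty_or_nonempty with rfl | hs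
  · have hd : DiffContOnCl ℂ (fun ζ => ζ * H ζ) (Metric.ball 0 |R|) := by
      refine DifferentiableOn.diffContOnCl ?_
      rw [habs, hcl]
      exact differentiableOn_id.mul hH
    simpa using hd.circleAverage
  · have hne : ∀ ζ ∈ Metric.sphere (0 : ℂ) |R|, ∀ i ∈ s, ζ ≠ v i := by
      rintro ζ hζ i hi rfl
      have := hvR i hi
      rw [mem_sphere_zero_iff_norm, habs] at hζ
      exact this.ne hζ
    have hcont : ∀ i ∈ s, ContinuousOn (fun ζ => Lagrange.nodalWeight s v i *
        (((ζ - 0) / (ζ - v i)) • H ζ)) (Metric.sphere (0 : ℂ) |R|) := by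
      intro i hi
      refine continuousOn_const.mul (ContinuousOn.fun_smul ?_ ?_)
      · exact ContinuousOn.div (by fun_prop) (by fun_prop)
          fun ζ hζ => sub_ne_zero.2 (hne ζ hζ i hi)
      · refine hH.continuousOn.mono ?_
        rw [habs]
        exact Metric.sphere_subset_closedBall
    rw [Real.circleAverage_congr_sphere
      (f₂ := fun ζ => ∑ i ∈ s, Lagrange.nodalWeight s v i * (((ζ - 0) / (ζ - v i)) • H ζ))]
    · rw [Real.circleAverage_fun_sum]
      · refine Finset.sum_congr rfl fun i hi => ?_
        have h1 := hHcl.circleAverage_smul_div (w := v i) (by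
          rw [mem_ball_zero_iff, habs]; exact hvR i hi)
        have h2 := Real.circleAverage_fun_smul (a := Lagrange.nodalWeight s v i)
          (f := fun ζ => ((ζ - 0) / (ζ - v i)) • H ζ) (c := 0) (R := R)
        simp only [smul_eq_mul] at h2 h1 ⊢
        rw [h2, h1, Lagrange.nodalWeight, Finset.prod_inv_distrib, div_eq_inv_mul]
      · intro i hi
        refine ContinuousOn.circleIntegrable' (hcont i hi)
    · intro ζ hζ
      have hx := hne ζ hζ
      -- Interpolating the constant 1 at the nodes is the partial fraction expansion of the inverse
      -- of the nodal polynomial.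
      have h := Lagrange.eval_interpolate_not_at_node (1 : ι → ℂ) hx
      rw [Lagrange.interpolate_one hv hs, Polynomial.eval_one, Lagrange.eval_nodal] at h
      have h0 : ∏ i ∈ s, (ζ - v i) ≠ 0 :=
        Finset.prod_ne_zero_iff.2 fun i hi => sub_ne_zero.2 (hx i hi)
      simp only [Pi.one_apply, mul_one] at h
      have h' : (∏ i ∈ s, (ζ - v i))⁻¹ = ∑ i ∈ s, Lagrange.nodalWeight s v i * (ζ - v i)⁻¹ :=
        inv_eq_of_mul_eq_one_right h.symm
      simp only
      rw [div_eq_mul_inv, h', Finset.mul_sum]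
      refine Finset.sum_congr rfl fun i _ => ?_
      rw [sub_zero, smul_eq_mul]
      ring

end Residues

/-! ### Residues under a common rotation -/

section OneBody

/-- A function with simple poles `χ c`, `c ∈ S`, that vanishes at the origin. -/
noncomputable def poleFun {ι : Type*} (S : Finset ι) (χ : ι → ℂ) (h : ℂ → ℂ) (z : ℂ) : ℂ :=
  z * h z / ∏ c ∈ S, (z - χ c)

/-- The limit of `(z - χ c) / z * poleFun S χ h z` at the pole `χ c`. -/
noncomputable def poleRes {ι : Type*} [DecidableEq ι] (S : Finset ι) (χ : ι → ℂ) (h : ℂ → ℂ)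
    (c : ι) : ℂ :=
  h (χ c) / ∏ c' ∈ S.erase c, (χ c - χ c')

/-- In ζ there is a pole at `χ c / x j` for each variable and each `c`. Distinct moduli of the `χ c`
together with distinct `x j` separate these points, so all poles are simple. At such a pole the
variable `j` sits at `χ c`, and all others lie on the circle of radius `‖χ c‖`. -/
theorem circleAverage_prod_poleFun {ι : Type*} [DecidableEq ι] (S : Finset ι) (χ : ι → ℂ)
    (h : ℂ → ℂ) {R : ℝ} (hR : 0 < R) (hχ0 : ∀ c ∈ S, χ c ≠ 0) (hχR : ∀ c ∈ S, ‖χ c‖ < R)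
    (hχ : Set.InjOn (fun c => ‖χ c‖) S)
    (hh : DifferentiableOn ℂ h (Metric.closedBall 0 R)) {m : ℕ} (x : Fin (m + 1) → ℂ)
    (hx1 : ∀ j, ‖x j‖ = 1) (hx : Function.Injective x) :
    Real.circleAverage (fun ζ => ∏ j, poleFun S χ h (ζ * x j)) 0 R =
      ∑ j, ∑ c ∈ S, poleRes S χ h c *
        ∏ k : Fin m, poleFun S χ h (χ c * (x (j.succAbove k) / x j)) := by
  have hx0 : ∀ j, x j ≠ 0 := fun j h0 => by simpa [h0] using hx1 j
  set v : Fin (m + 1) × ι → ℂ := fun p => χ p.2 / x p.1 with hv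
  -- Of the `m + 1` factors ζ one stays outside `H`: it cancels the 1/ζ hidden in the circle
  -- average.
  set H : ℂ → ℂ := fun ζ => ζ ^ m * ∏ j, (x j * h (ζ * x j) / ∏ _c ∈ S, x j) with hHdef
  have hvn : ∀ p, ‖v p‖ = ‖χ p.2‖ := fun p => by simp [hv, hx1]
  have hinj : Set.InjOn v (Finset.univ ×ˢ S : Finset (Fin (m + 1) × ι)) := by
    rintro ⟨j, c⟩ hp ⟨j', c'⟩ hp' heq
    simp only [Finset.coe_product, Set.mem_prod, Finset.mem_coe] at hp hp'
    have hn : ‖χ c‖ = ‖χ c'‖ := by rw [← hvn (j, c), ← hvn (j', c'), heq]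
    obtain rfl : c = c' := hχ hp.2 hp'.2 hn
    simp only [hv] at heq
    have := hx0 j
    have := hx0 j'
    have := hχ0 c hp.2
    rw [div_eq_div_iff (hx0 j) (hx0 j')] at heq
    rw [hx (mul_left_cancel₀ this heq.symm)]
  have key := circleAverage_mul_div_prod_sub (Finset.univ ×ˢ S) v H hR hinj
    (fun p hp => by rw [hvn]; exact hχR _ (Finset.mem_product.1 hp).2) (by
      refine DifferentiableOn.mul (by fun_prop) ?_
      refine DifferentiableOn.fun_finsetProd fun j _ => ?_
      refine DifferentiableOn.div_const (DifferentiableOn.const_mul ?_ _) _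
      refine DifferentiableOn.comp (g := h) (f := fun ζ => ζ * x j) hh (by fun_prop) ?_
      intro ζ hζ
      simpa [hx1] using hζ)
  have hfac : ∀ ζ j, poleFun S χ h (ζ * x j) =
      ζ * (x j * h (ζ * x j) / ∏ _c ∈ S, x j) / ∏ c ∈ S, (ζ - v (j, c)) := by
    intro ζ j
    have : ∏ c ∈ S, (ζ * x j - χ c) = (∏ _c ∈ S, x j) * ∏ c ∈ S, (ζ - v (j, c)) := by
      rw [← Finset.prod_mul_distrib]
      refine Finset.prod_congr rfl fun c _ => ?_
      simp only [hv]
      field_simp [hx0 j]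
    rw [poleFun, this]
    have := hx0 j
    have h3 : ∏ _c ∈ S, x j ≠ 0 := Finset.prod_ne_zero_iff.2 fun _ _ => this
    rw [mul_div_assoc', div_div, mul_assoc]
  have hprod : ∀ ζ, ∏ j, poleFun S χ h (ζ * x j) =
      ζ * H ζ / ∏ p ∈ Finset.univ ×ˢ S, (ζ - v p) := by
    intro ζ
    simp only [hfac]
    rw [Finset.prod_div_distrib, Finset.prod_mul_distrib, Finset.prod_product]
    simp only [hHdef, Finset.prod_const, Finset.card_univ, Fintype.card_fin]
    ring
  simp only [hprod]
  rw [key, Finset.sum_product]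
  refine Finset.sum_congr rfl fun j _ => Finset.sum_congr rfl fun c hc => ?_
  have hsplit : ∏ p ∈ (Finset.univ ×ˢ S).erase (j, c), (v (j, c) - v p) =
      (∏ c' ∈ S.erase c, (v (j, c) - v (j, c'))) *
        ∏ k : Fin m, ∏ c' ∈ S, (v (j, c) - v (j.succAbove k, c')) := by
    have hset : (Finset.univ ×ˢ S).erase (j, c) =
        ({j} ×ˢ S.erase c) ∪ ((Finset.univ.erase j) ×ˢ S) := by
      ext ⟨a, b⟩
      simp only [Finset.mem_erase, Finset.mem_product, Finset.mem_univ, Finset.mem_union,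
        Finset.mem_singleton, Prod.mk.injEq, ne_eq]
      tauto
    have hdisj : Disjoint ({j} ×ˢ S.erase c) ((Finset.univ.erase j) ×ˢ S) := by
      rw [Finset.disjoint_left]
      rintro ⟨a, b⟩ h1 h2
      simp only [Finset.mem_product, Finset.mem_singleton, Finset.mem_erase] at h1 h2
      exact h2.1.1 h1.1
    rw [hset, Finset.prod_union hdisj, Finset.prod_product, Finset.prod_product,
      Finset.prod_singleton]
    congr 1
    have := Fin.prod_univ_succAbove (fun a => if a = j then 1 else ∏ c' ∈ S, (v (j, c) - v (a, c'))) j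
    simp only [Fin.succAbove_ne, if_true, if_false, one_mul] at this
    rw [← this, ← Finset.mul_prod_erase Finset.univ _ (Finset.mem_univ j), if_pos rfl, one_mul]
    exact Finset.prod_congr rfl fun a ha => (if_neg (Finset.ne_of_mem_erase ha)).symm
  have hk : ∀ k, poleFun S χ h (χ c * (x (j.succAbove k) / x j)) =
      v (j, c) * (x (j.succAbove k) * h (v (j, c) * x (j.succAbove k)) / ∏ _c ∈ S, x (j.succAbove k))
        / ∏ c' ∈ S, (v (j, c) - v (j.succAbove k, c')) := by
    intro k
    rw [← hfac]
    congr 1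
    simp only [hv]
    ring
  have hjc : ∏ c' ∈ S.erase c, (v (j, c) - v (j, c')) =
      (∏ c' ∈ S.erase c, (χ c - χ c')) / ∏ _c ∈ S.erase c, x j := by
    rw [← Finset.prod_div_distrib]
    refine Finset.prod_congr rfl fun c' _ => ?_
    simp only [hv]
    ring
  rw [hsplit]
  simp only [hk]
  rw [Finset.prod_div_distrib, Finset.prod_mul_distrib, hjc, poleRes, hHdef]
  simp only
  rw [Fin.prod_univ_succAbove _ j, Finset.prod_const (v (j, c)), Finset.card_univ,
    Fintype.card_fin, ← Finset.mul_prod_erase S _ hc]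
  have h1 : v (j, c) * x j = χ c := by simp only [hv]; field_simp [hx0 j]
  rw [h1]
  have h3 : ∏ _c ∈ S.erase c, x j ≠ 0 := Finset.prod_ne_zero_iff.2 fun _ _ => hx0 j
  have h4 := hx0 j
  rw [mul_div_mul_left _ _ h4]
  generalize ∏ _c ∈ S.erase c, x j = X at *
  generalize ∏ k, x (j.succAbove k) * h (v (j, c) * x (j.succAbove k)) /
    ∏ _c ∈ S, x (j.succAbove k) = P
  field_simp

end OneBody

/-! ### Haar measure on the torus -/

section Torus

instance factTwoPiPos : Fact (0 < 2 * π) := ⟨Real.two_pi_pos⟩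

/-- The point `exp (iθ)` of the unit circle in `ℂ`. -/
noncomputable def unitPt (θ : AddCircle (2 * π)) : ℂ := (AddCircle.toCircle θ : ℂ)

theorem norm_unitPt (θ : AddCircle (2 * π)) : ‖unitPt θ‖ = 1 := Circle.norm_coe _

theorem unitPt_ne_zero (θ : AddCircle (2 * π)) : unitPt θ ≠ 0 := Circle.coe_ne_zero _

theorem continuous_unitPt : Continuous unitPt :=
  continuous_subtype_val.comp AddCircle.continuous_toCircle

theorem unitPt_add (θ φ : AddCircle (2 * π)) : unitPt (θ + φ) = unitPt θ * unitPt φ := by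
  simp [unitPt, AddCircle.toCircle_add]

theorem unitPt_sub (θ φ : AddCircle (2 * π)) : unitPt (θ - φ) = unitPt θ / unitPt φ := by
  rw [eq_div_iff (unitPt_ne_zero φ), ← unitPt_add, sub_add_cancel]

theorem unitPt_injective : Function.Injective unitPt :=
  Subtype.val_injective.comp (AddCircle.injective_toCircle Real.two_pi_pos.ne')

theorem unitPt_coe (x : ℝ) : unitPt (x : AddCircle (2 * π)) = Complex.exp (x * Complex.I) := by
  rw [unitPt, AddCircle.toCircle_apply_mk, div_self Real.two_pi_pos.ne', one_mul, Circle.coe_exp]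

theorem exists_unitPt_eq {z : ℂ} (hz : ‖z‖ = 1) : ∃ θ, unitPt θ = z :=
  ⟨(z.arg : AddCircle (2 * π)), by
    rw [unitPt_coe]; simpa [hz] using Complex.norm_mul_exp_arg_mul_I z⟩

/-- The normalised Haar measure of the torus. -/
noncomputable def torusMeasure (m : ℕ) : Measure (Fin m → AddCircle (2 * π)) :=
  Measure.pi fun _ => AddCircle.haarAddCircle

instance (m : ℕ) : IsProbabilityMeasure (torusMeasure m) := by
  unfold torusMeasure; infer_instance

instance (m : ℕ) : (torusMeasure m).IsAddHaarMeasure := by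
  unfold torusMeasure; infer_instance

theorem integral_unitPt_eq_circleAverage (f : ℂ → ℂ) (R : ℝ) :
    ∫ θ, f (R * unitPt θ) ∂AddCircle.haarAddCircle = Real.circleAverage f 0 R := by
  rw [AddCircle.integral_haarAddCircle, Real.circleAverage,
    ← AddCircle.intervalIntegral_preimage (2 * π) 0]
  simp [unitPt_coe, circleMap]

/-- The circle has no isolated points, so its Haar measure has no atoms. Identities of one-body
functions are thus needed only off finite sets. -/
theorem ae_unitPt_notMem {A : Set ℂ} (hA : A.Finite) (m : ℕ) (c : ℂ) (hc : c ≠ 0) :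
    ∀ᵐ w ∂torusMeasure m, ∀ k, c * unitPt (w k) ∉ A := by
  have h1 : ∀ᵐ θ ∂(AddCircle.haarAddCircle (T := 2 * π)), c * unitPt θ ∉ A := by
    have : Nontrivial (AddCircle (2 * π)) := by
      obtain ⟨θ, hθ⟩ := exists_unitPt_eq (z := -1) (by simp)
      refine ⟨θ, 0, ?_⟩
      rintro rfl
      norm_num [unitPt] at hθ
    have : (𝓝[≠] (0 : AddCircle (2 * π))).NeBot := PerfectSpace.not_isolated 0
    have : NullSingletonClass (AddCircle.haarAddCircle (T := 2 * π)) :=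
      Measure.IsAddHaarMeasure.nullSingletonClass _
    have hfin : {θ | c * unitPt θ ∈ A}.Finite :=
      hA.preimage ((mul_right_injective₀ hc).comp unitPt_injective).injOn
    rw [ae_iff]
    simpa using hfin.measure_zero _
  exact Filter.eventually_all.2 fun k => (Measure.tendsto_eval_ae_ae
    (μ := fun _ : Fin m => AddCircle.haarAddCircle (T := 2 * π)) (i := k)).eventually h1

/-- A surjective continuous homomorphism of compact groups carries normalised Haar measure to
normalised Haar measure. The map passes to coordinates relative to the variable that sits at the
pole. -/
theorem measurePreserving_sub_coord {m : ℕ} (j : Fin (m + 1)) :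
    MeasurePreserving (fun (w : Fin (m + 1) → AddCircle (2 * π)) (k : Fin m) =>
      w (j.succAbove k) - w j) (torusMeasure (m + 1)) (torusMeasure m) := by
  let f : (Fin (m + 1) → AddCircle (2 * π)) →+ (Fin m → AddCircle (2 * π)) :=
    { toFun := fun w k => w (j.succAbove k) - w j
      map_zero' := by ext; simp
      map_add' := fun x y => by ext k; simp; abel }
  refine f.measurePreserving (continuous_pi fun k => ?_) (fun x => ?_) ?_
  · show Continuous fun w : Fin (m + 1) → AddCircle (2 * π) => w (j.succAbove k) - w j
    fun_prop
  · refine ⟨j.insertNth 0 x, ?_⟩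
    ext k
    simp [f]
  · simp

theorem measurePreserving_add_const (m : ℕ) :
    MeasurePreserving (fun (p : AddCircle (2 * π) × (Fin m → AddCircle (2 * π))) (k : Fin m) =>
      p.1 + p.2 k) (AddCircle.haarAddCircle.prod (torusMeasure m)) (torusMeasure m) := by
  let f : (AddCircle (2 * π) × (Fin m → AddCircle (2 * π))) →+ (Fin m → AddCircle (2 * π)) :=
    { toFun := fun p k => p.1 + p.2 k
      map_zero' := by ext; simp
      map_add' := fun x y => by ext k; simp; abel }
  refine f.measurePreserving (continuous_pi fun k => ?_) (fun x => ?_) ?_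
  · show Continuous fun p : AddCircle (2 * π) × (Fin m → AddCircle (2 * π)) => p.1 + p.2 k
    fun_prop
  · exact ⟨(0, x), by ext k; simp [f]⟩
  · simp

/-- A coincidence of two coordinates is a vanishing relative coordinate, which is a null event by
`measurePreserving_sub_coord`. -/
theorem ae_injective (m : ℕ) : ∀ᵐ w ∂torusMeasure m, Function.Injective w := by
  rcases m with _ | m
  · exact Eventually.of_forall fun w => Function.injective_of_subsingleton w
  have h : ∀ᵐ w ∂torusMeasure (m + 1), ∀ (j : Fin (m + 1)) (k : Fin m),
      w (j.succAbove k) ≠ w j := by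
    refine Filter.eventually_all.2 fun j => ?_
    have h0 : ∀ᵐ x ∂torusMeasure m, ∀ k, (1 : ℂ) * unitPt (x k) ∉ ({1} : Set ℂ) :=
      ae_unitPt_notMem (Set.finite_singleton 1) m 1 one_ne_zero
    have h1 := (measurePreserving_sub_coord j).quasiMeasurePreserving.ae h0
    filter_upwards [h1] with w hw k hk
    refine hw k ?_
    simp [hk, unitPt]
  filter_upwards [h] with w hw a b hab
  by_contra hne
  obtain ⟨k, rfl⟩ := Fin.exists_succAbove_eq hne
  exact hw b k hab

end Torus

/-! ### The two-body interaction -/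

section Interaction

variable (q₁ q₂ : ℂ)

/-- The interaction factor of an ordered pair of variables. -/
noncomputable def pairK (x y : ℂ) : ℂ :=
  ((x - y) * (x - q₁ * q₂ * y)) / ((x - q₁ * y) * (x - q₂ * y))

/-- The interaction `∏_{j ≠ k} (z_j - z_k)(z_j - q₁q₂z_k) / ((z_j - q₁z_k)(z_j - q₂z_k))`. -/
noncomputable def interaction {m : ℕ} (z : Fin m → ℂ) : ℂ :=
  ∏ j, ∏ k ∈ Finset.univ.erase j, pairK q₁ q₂ (z j) (z k)

variable {q₁ q₂}

theorem pairK_smul {c : ℂ} (hc : c ≠ 0) (x y : ℂ) :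
    pairK q₁ q₂ (c * x) (c * y) = pairK q₁ q₂ x y := by
  have hcc : c * c ≠ 0 := mul_ne_zero hc hc
  rw [pairK, pairK, ← mul_div_mul_left ((x - y) * (x - q₁ * q₂ * y)) _ hcc]
  congr 1 <;> ring

/-- This homogeneity makes the interaction a constant for the residue theorem in the common
rotation. -/
theorem interaction_smul {c : ℂ} (hc : c ≠ 0) {m : ℕ} (z : Fin m → ℂ) :
    interaction q₁ q₂ (fun j => c * z j) = interaction q₁ q₂ z := by
  simp only [interaction, pairK_smul hc]

theorem prod_erase_succAbove {M : Type*} [CommMonoid M] {m : ℕ} (j : Fin (m + 1))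
    (f : Fin (m + 1) → M) : ∏ k ∈ Finset.univ.erase j, f k = ∏ k, f (j.succAbove k) := by
  rw [← Finset.compl_singleton, ← Fin.image_succAbove_univ,
    Finset.prod_image fun _ _ _ _ h => Fin.succAbove_right_injective h]

/-- Splits off both orders of every pair containing `j`; they become the new one-body factor once
the variable `j` is fixed at a pole. -/
theorem interaction_succAbove {m : ℕ} (j : Fin (m + 1)) (z : Fin (m + 1) → ℂ) :
    interaction q₁ q₂ z =
      (∏ k, pairK q₁ q₂ (z (j.succAbove k)) (z j) * pairK q₁ q₂ (z j) (z (j.succAbove k))) *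
        interaction q₁ q₂ (fun k => z (j.succAbove k)) := by
  rw [interaction, Fin.prod_univ_succAbove _ j, prod_erase_succAbove, Finset.prod_mul_distrib,
    interaction]
  have : ∀ k : Fin m, ∏ l ∈ Finset.univ.erase (j.succAbove k), pairK q₁ q₂ (z (j.succAbove k)) (z l)
      = pairK q₁ q₂ (z (j.succAbove k)) (z j) *
        ∏ l ∈ Finset.univ.erase k, pairK q₁ q₂ (z (j.succAbove k)) (z (j.succAbove l)) := by
    intro k
    rw [← Finset.mul_prod_erase _ _ (Finset.mem_erase.2
      ⟨(Fin.succAbove_ne j k).symm, Finset.mem_univ j⟩)]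
    congr 1
    rw [← Finset.prod_image (f := fun l => pairK q₁ q₂ (z (j.succAbove k)) (z l))
      (g := j.succAbove) fun _ _ _ _ h => Fin.succAbove_right_injective h]
    congr 1
    ext l
    rcases eq_or_ne l j with rfl | hl
    · simp [Fin.succAbove_ne]
    · obtain ⟨l', rfl⟩ := Fin.exists_succAbove_eq hl
      simp [hl]
  simp only [this, Finset.prod_mul_distrib]
  ring

theorem pairK_den_ne_zero (hq₁ : ‖q₁‖ < 1) (hq₂ : ‖q₂‖ < 1) {x y : ℂ} (hx : x ≠ 0)
    (hxy : ‖y‖ ≤ ‖x‖) : (x - q₁ * y) * (x - q₂ * y) ≠ 0 := by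
  have key : ∀ q : ℂ, ‖q‖ < 1 → x - q * y ≠ 0 := by
    intro q hq h
    have h1 : ‖x‖ = ‖q‖ * ‖y‖ := by rw [sub_eq_zero.1 h, norm_mul]
    have h2 : 0 < ‖x‖ := norm_pos_iff.2 hx
    nlinarith [norm_nonneg q, norm_nonneg y]
  exact mul_ne_zero (key _ hq₁) (key _ hq₂)

theorem continuous_interaction_unitPt (hq₁ : ‖q₁‖ < 1) (hq₂ : ‖q₂‖ < 1) (m : ℕ) :
    Continuous fun w : Fin m → AddCircle (2 * π) => interaction q₁ q₂ fun j => unitPt (w j) := by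
  have := continuous_unitPt
  unfold interaction
  refine continuous_finsetProd _ fun j _ => continuous_finsetProd _ fun k _ => ?_
  unfold pairK
  refine Continuous.div (by fun_prop) (by fun_prop) fun w => ?_
  exact pairK_den_ne_zero hq₁ hq₂ (unitPt_ne_zero _) (by simp [norm_unitPt])

end Interaction

/-! ### Averages over the torus and the residue recursion -/

section TorusAverage

variable (q₁ q₂ : ℂ)

/-- The average over the torus of a product of one-body functions times the interaction. -/
noncomputable def torusAvg (m : ℕ) (G : AddCircle (2 * π) → ℂ) : ℂ :=
  ∫ w, (∏ j, G (w j)) * interaction q₁ q₂ (fun j => unitPt (w j)) ∂torusMeasure m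

theorem torusAvg_zero (G : AddCircle (2 * π) → ℂ) : torusAvg q₁ q₂ 0 G = 1 := by
  simp [torusAvg, interaction]

/-- One-body functions that agree off finitely many points have the same average. -/
theorem torusAvg_congr {m : ℕ} {f g : ℂ → ℂ} {c : ℂ} (hc : c ≠ 0) {A : Set ℂ} (hA : A.Finite)
    (hfg : ∀ θ, c * unitPt θ ∉ A → f (c * unitPt θ) = g (c * unitPt θ)) :
    torusAvg q₁ q₂ m (fun θ => f (c * unitPt θ)) = torusAvg q₁ q₂ m (fun θ => g (c * unitPt θ)) := by
  refine integral_congr_ae ?_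
  filter_upwards [ae_unitPt_notMem hA m c hc] with w hw
  congr 1
  exact Finset.prod_congr rfl fun j _ => hfg _ (hw j)

/-- The average does not change when the circle is rotated. -/
theorem torusAvg_rotate {m : ℕ} (f : ℂ → ℂ) (c : ℂ) :
    torusAvg q₁ q₂ m (fun θ => f (c * unitPt θ)) =
      torusAvg q₁ q₂ m (fun θ => f (‖c‖ * unitPt θ)) := by
  rcases eq_or_ne c 0 with rfl | hc
  · simp
  have hn : (‖c‖ : ℂ) ≠ 0 := by simpa using hc
  obtain ⟨φ, hφ⟩ := exists_unitPt_eq (z := c / ‖c‖) (by simp [hc])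
  have hcφ : c = ‖c‖ * unitPt φ := by rw [hφ]; field_simp
  have hmp : MeasurePreserving (fun w : Fin m → AddCircle (2 * π) => (fun _ => φ) + w)
      (torusMeasure m) (torusMeasure m) := measurePreserving_add_left _ _
  have he : MeasurableEmbedding (fun w : Fin m → AddCircle (2 * π) => (fun _ => φ) + w) :=
    measurableEmbedding_addLeft _
  unfold torusAvg
  rw [← hmp.integral_comp he (fun w => (∏ j, f (‖c‖ * unitPt (w j))) *
    interaction q₁ q₂ fun j => unitPt (w j))]
  refine integral_congr_ae (Eventually.of_forall fun w => ?_)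
  simp only [Pi.add_apply, unitPt_add, interaction_smul (unitPt_ne_zero φ), ← mul_assoc, ← hcφ]

variable {q₁ q₂}

theorem integrable_prod_interaction (hq₁ : ‖q₁‖ < 1) (hq₂ : ‖q₂‖ < 1) {m : ℕ}
    {G : AddCircle (2 * π) → ℂ} (hG : Continuous G) :
    Integrable (fun w => (∏ j, G (w j)) * interaction q₁ q₂ (fun j => unitPt (w j)))
      (torusMeasure m) := by
  have := continuous_interaction_unitPt hq₁ hq₂ m
  refine Continuous.integrable_of_hasCompactSupport ?_ (HasCompactSupport.of_compactSpace _)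
  fun_prop

/-- Averaging over a common rotation of all variables. -/
theorem torusAvg_eq_integral_circleAverage (hq₁ : ‖q₁‖ < 1) (hq₂ : ‖q₂‖ < 1) {m : ℕ}
    (f : ℂ → ℂ) (R : ℝ) (hf : Continuous fun θ => f (R * unitPt θ)) :
    torusAvg q₁ q₂ m (fun θ => f (R * unitPt θ)) =
      ∫ w, Real.circleAverage (fun ζ => ∏ j, f (ζ * unitPt (w j))) 0 R *
        interaction q₁ q₂ (fun j => unitPt (w j)) ∂torusMeasure m := by
  have hmp := measurePreserving_add_const m
  have hint := integrable_prod_interaction hq₁ hq₂ (m := m) hf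
  unfold torusAvg
  -- Inserts a redundant common rotation as an additional integration variable.
  have hmap := integral_map (μ := AddCircle.haarAddCircle.prod (torusMeasure m))
    hmp.measurable.aemeasurable (f := fun w => (∏ j, f (R * unitPt (w j))) *
      interaction q₁ q₂ (fun j => unitPt (w j)))
    (by rw [hmp.map_eq]; exact hint.aestronglyMeasurable)
  rw [hmp.map_eq] at hmap
  refine hmap.trans ((integral_prod_symm _
    ((hmp.integrable_comp hint.aestronglyMeasurable).2 hint)).trans ?_)
  refine integral_congr_ae (Eventually.of_forall fun w => ?_)
  simp only [Function.comp_def, unitPt_add, interaction_smul (unitPt_ne_zero _), ← mul_assoc]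
  rw [integral_mul_const, integral_unitPt_eq_circleAverage (fun ζ => ∏ j, f (ζ * unitPt (w j)))]

/-- The integrand of the residue at `χ c`, as a function of the other variables. -/
theorem integrable_residue (hq₁ : ‖q₁‖ < 1) (hq₂ : ‖q₂‖ < 1) {ι : Type*} [DecidableEq ι]
    {S : Finset ι} {χ : ι → ℂ} {h : ℂ → ℂ} {R : ℝ} (hχ0 : ∀ c ∈ S, χ c ≠ 0)
    (hχR : ∀ c ∈ S, ‖χ c‖ < R) (hχ : Set.InjOn (fun c => ‖χ c‖) S)
    (hh : ContinuousOn h (Metric.closedBall 0 R)) {c : ι} (hc : c ∈ S) (m : ℕ) :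
    Integrable (fun w => (∏ j, poleFun S χ h (χ c * unitPt (w j)) *
        (pairK q₁ q₂ (χ c * unitPt (w j)) (χ c) * pairK q₁ q₂ (χ c) (χ c * unitPt (w j)))) *
      interaction q₁ q₂ (fun j => unitPt (w j))) (torusMeasure m) := by
  -- The integrand with the pole at `χ c` cancelled against the factor `z - χ c` of `pairK`. The
  -- other poles have different moduli, so `G` is continuous on the circle through `χ c`.
  set G : ℂ → ℂ := fun z => z * h z / (∏ c' ∈ S.erase c, (z - χ c')) *
    ((z - q₁ * q₂ * χ c) / ((z - q₁ * χ c) * (z - q₂ * χ c)) * pairK q₁ q₂ (χ c) z) with hG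
  have hcont : Continuous fun θ => G (χ c * unitPt θ) := by
    have hu := continuous_unitPt
    have hn : ∀ θ, ‖χ c * unitPt θ‖ = ‖χ c‖ := fun θ => by simp [norm_unitPt]
    have hz : ∀ θ, χ c * unitPt θ ≠ 0 := fun θ => mul_ne_zero (hχ0 c hc) (unitPt_ne_zero θ)
    have hhc : Continuous fun θ => h (χ c * unitPt θ) := by
      refine hh.comp_continuous (by fun_prop) fun θ => ?_
      rw [mem_closedBall_zero_iff, hn]
      exact (hχR c hc).le
    simp only [hG, pairK]
    refine Continuous.mul (Continuous.div (Continuous.mul (by fun_prop) hhc) (by fun_prop)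
      fun θ => ?_) (Continuous.mul (Continuous.div (by fun_prop) (by fun_prop) fun θ => ?_)
        (Continuous.div (by fun_prop) (by fun_prop) fun θ => ?_))
    · refine Finset.prod_ne_zero_iff.2 fun c' hc' h0 => ?_
      rw [Finset.mem_erase] at hc'
      refine hc'.1 (hχ hc'.2 hc ?_)
      simp only
      rw [← hn θ, sub_eq_zero.1 h0]
    · exact pairK_den_ne_zero hq₁ hq₂ (hz θ) (hn θ).ge
    · exact pairK_den_ne_zero hq₁ hq₂ (hχ0 c hc) (hn θ).le
  refine (integrable_prod_interaction hq₁ hq₂ (m := m) hcont).congr ?_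
  filter_upwards [ae_unitPt_notMem (Set.finite_singleton (χ c)) m (χ c) (hχ0 c hc)] with w hw
  congr 1
  refine Finset.prod_congr rfl fun j _ => ?_
  have hne : χ c * unitPt (w j) - χ c ≠ 0 := sub_ne_zero.2 (hw j)
  simp only [hG, poleFun]
  rw [← Finset.mul_prod_erase S _ hc]
  generalize pairK q₁ q₂ (χ c) (χ c * unitPt (w j)) = P
  rw [pairK]
  generalize χ c * unitPt (w j) = z at *
  rw [mul_div_assoc (z - χ c), ← mul_assoc, ← mul_assoc]
  congr 1
  field_simp

/-- The recursion that takes the residues in one of the variables. -/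
theorem torusAvg_succ_poleFun (hq₁ : ‖q₁‖ < 1) (hq₂ : ‖q₂‖ < 1) {ι : Type*} [DecidableEq ι]
    {S : Finset ι} {χ : ι → ℂ} {h : ℂ → ℂ} {R : ℝ} (hR : 0 < R) (hχ0 : ∀ c ∈ S, χ c ≠ 0)
    (hχR : ∀ c ∈ S, ‖χ c‖ < R) (hχ : Set.InjOn (fun c => ‖χ c‖) S)
    (hh : DifferentiableOn ℂ h (Metric.closedBall 0 R)) (m : ℕ) :
    torusAvg q₁ q₂ (m + 1) (fun θ => poleFun S χ h (R * unitPt θ)) =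
      (m + 1) * ∑ c ∈ S, poleRes S χ h c * torusAvg q₁ q₂ m (fun θ =>
        poleFun S χ h (χ c * unitPt θ) *
          (pairK q₁ q₂ (χ c * unitPt θ) (χ c) * pairK q₁ q₂ (χ c) (χ c * unitPt θ))) := by
  have hcont : Continuous fun θ => poleFun S χ h (R * unitPt θ) := by
    have hu := continuous_unitPt
    have hn : ∀ θ, ‖(R : ℂ) * unitPt θ‖ = R := fun θ => by simp [norm_unitPt, hR.le]
    have hhc : Continuous fun θ => h (R * unitPt θ) := by
      refine hh.continuousOn.comp_continuous (by fun_prop) fun θ => ?_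
      rw [mem_closedBall_zero_iff, hn]
    refine Continuous.div (Continuous.mul (by fun_prop) hhc) (by fun_prop) fun θ => ?_
    refine Finset.prod_ne_zero_iff.2 fun c hc h0 => (hχR c hc).ne ?_
    rw [← sub_eq_zero.1 h0, hn]
  set Φ : ι → (Fin m → AddCircle (2 * π)) → ℂ := fun c w =>
    (∏ j, poleFun S χ h (χ c * unitPt (w j)) *
        (pairK q₁ q₂ (χ c * unitPt (w j)) (χ c) * pairK q₁ q₂ (χ c) (χ c * unitPt (w j)))) *
      interaction q₁ q₂ (fun j => unitPt (w j)) with hΦ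
  have hint : ∀ c ∈ S, Integrable (Φ c) (torusMeasure m) := fun c hc =>
    integrable_residue hq₁ hq₂ hχ0 hχR hχ hh.continuousOn hc m
  -- By homogeneity each residue depends only on the coordinates relative to the variable `j` that
  -- was caught at the pole.
  have hpt : ∀ w : Fin (m + 1) → AddCircle (2 * π), Function.Injective w →
      Real.circleAverage (fun ζ => ∏ j, poleFun S χ h (ζ * unitPt (w j))) 0 R *
        interaction q₁ q₂ (fun j => unitPt (w j)) =
      ∑ j, ∑ c ∈ S, poleRes S χ h c * Φ c (fun k => w (j.succAbove k) - w j) := by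
    intro w hw
    rw [circleAverage_prod_poleFun S χ h hR hχ0 hχR hχ hh _ (fun j => norm_unitPt _)
      (unitPt_injective.comp hw), Finset.sum_mul]
    refine Finset.sum_congr rfl fun j _ => ?_
    rw [Finset.sum_mul]
    refine Finset.sum_congr rfl fun c hc => ?_
    have hj := unitPt_ne_zero (w j)
    have hc0 := hχ0 c hc
    have hI : interaction q₁ q₂ (fun k => unitPt (w (j.succAbove k) - w j)) =
        interaction q₁ q₂ (fun k => unitPt (w (j.succAbove k))) := by
      rw [← interaction_smul (inv_ne_zero hj) (fun k => unitPt (w (j.succAbove k)))]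
      congr 1
      ext k
      rw [unitPt_sub, div_eq_inv_mul]
    have hd : χ c / unitPt (w j) ≠ 0 := div_ne_zero hc0 hj
    have hK : ∀ k, pairK q₁ q₂ (unitPt (w (j.succAbove k))) (unitPt (w j)) =
        pairK q₁ q₂ (χ c * unitPt (w (j.succAbove k) - w j)) (χ c) := by
      intro k
      rw [← pairK_smul hd, unitPt_sub]
      congr 1 <;> field_simp
    have hK' : ∀ k, pairK q₁ q₂ (unitPt (w j)) (unitPt (w (j.succAbove k))) =
        pairK q₁ q₂ (χ c) (χ c * unitPt (w (j.succAbove k) - w j)) := by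
      intro k
      rw [← pairK_smul hd, unitPt_sub]
      congr 1 <;> field_simp
    rw [interaction_succAbove j]
    simp only [hΦ, hK, hK', hI, ← unitPt_sub, Finset.prod_mul_distrib]
    ring
  rw [torusAvg_eq_integral_circleAverage hq₁ hq₂ _ R hcont]
  rw [integral_congr_ae (g := fun w => ∑ j, ∑ c ∈ S, poleRes S χ h c *
    Φ c (fun k => w (j.succAbove k) - w j))
    (by filter_upwards [ae_injective (m + 1)] with w hw using hpt w hw)]
  have hint' : ∀ (j : Fin (m + 1)), ∀ c ∈ S, Integrable (fun w => poleRes S χ h c *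
      Φ c (fun k => w (j.succAbove k) - w j)) (torusMeasure (m + 1)) := fun j c hc =>
    (((measurePreserving_sub_coord j).integrable_comp (hint c hc).aestronglyMeasurable).2
      (hint c hc)).const_mul _
  -- The relative coordinates are again Haar distributed, so every `j` contributes equally. This is
  -- the origin of the factor `m + 1`.
  have hval : ∀ (j : Fin (m + 1)), ∀ c ∈ S, ∫ w, Φ c (fun k => w (j.succAbove k) - w j)
      ∂torusMeasure (m + 1) = ∫ w, Φ c w ∂torusMeasure m := by
    intro j c hc
    have hmp := measurePreserving_sub_coord j
    have hmap := integral_map (μ := torusMeasure (m + 1)) hmp.measurable.aemeasurable (f := Φ c)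
      (by rw [hmp.map_eq]; exact (hint c hc).aestronglyMeasurable)
    rw [hmp.map_eq] at hmap
    exact hmap.symm
  rw [integral_finsetSum _ fun j _ => integrable_finsetSum _ (hint' j)]
  have : ∀ j ∈ (Finset.univ : Finset (Fin (m + 1))), ∫ w, ∑ c ∈ S, poleRes S χ h c *
      Φ c (fun k => w (j.succAbove k) - w j) ∂torusMeasure (m + 1) =
      ∑ c ∈ S, poleRes S χ h c * ∫ w, Φ c w ∂torusMeasure m := by
    intro j _
    rw [integral_finsetSum _ (hint' j)]
    refine Finset.sum_congr rfl fun c hc => ?_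
    rw [integral_const_mul, hval j c hc]
  rw [Finset.sum_congr rfl this, Finset.sum_const, Finset.card_univ, Fintype.card_fin, nsmul_eq_mul]
  push_cast
  rfl

end TorusAverage

/-! ### From the contour integral to the torus average -/

section TorusIntegral

theorem measure_pi_smul {m : ℕ} {X : Type*} [MeasurableSpace X] (ν : Measure X) [IsFiniteMeasure ν]
    (c : ENNReal) (hc : c ≠ ⊤) :
    Measure.pi (fun _ : Fin m => c • ν) = c ^ m • Measure.pi (fun _ : Fin m => ν) := by
  have : IsFiniteMeasure (c • ν) := ν.smul_finite hc
  refine Measure.pi_eq fun s _ => ?_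
  simp [Measure.pi_pi, Finset.prod_mul_distrib]

/-- Up to a null set the cube is a fundamental domain. Each circle has volume 2π relative to
normalised Haar measure, which gives the power. -/
theorem setIntegral_Icc_torus {m : ℕ} (F : (Fin m → AddCircle (2 * π)) → ℂ)
    (hF : Continuous F) :
    ∫ θ in Set.Icc (0 : Fin m → ℝ) (fun _ => 2 * π), F (fun j => (θ j : AddCircle (2 * π))) =
      (2 * π : ℂ) ^ m * ∫ w, F w ∂torusMeasure m := by
  have h1 : (volume : Measure (Fin m → ℝ)).restrict (Set.Icc 0 fun _ => 2 * π) =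
      Measure.pi fun _ => (volume : Measure ℝ).restrict (Set.Ioc 0 (0 + 2 * π)) := by
    rw [← Measure.restrict_pi_pi, volume_pi]
    simp only [zero_add]
    exact (Measure.restrict_congr_set
      (Measure.univ_pi_Ioc_ae_eq_Icc (f := (0 : Fin m → ℝ)) (g := fun _ => 2 * π))).symm
  have hmp : MeasurePreserving (fun (θ : Fin m → ℝ) j => (θ j : AddCircle (2 * π)))
      (Measure.pi fun _ => (volume : Measure ℝ).restrict (Set.Ioc 0 (0 + 2 * π)))
      (Measure.pi fun _ => volume) :=
    measurePreserving_pi _ _ fun _ => AddCircle.measurePreserving_mk (2 * π) 0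
  have hmap := integral_map
    (μ := Measure.pi fun _ => (volume : Measure ℝ).restrict (Set.Ioc 0 (0 + 2 * π)))
    hmp.measurable.aemeasurable (f := F)
    hF.aestronglyMeasurable
  rw [h1, ← hmap, hmp.map_eq]
  simp only [AddCircle.volume_eq_smul_haarAddCircle]
  rw [measure_pi_smul _ _ ENNReal.ofReal_ne_top, integral_smul_measure]
  rw [ENNReal.toReal_pow, ENNReal.toReal_ofReal Real.two_pi_pos.le, Complex.real_smul]
  simp [torusMeasure]

variable {q₁ q₂ : ℂ} {r s : ℕ}

/-- The one-body factor of the integrand, without the measure `dz / (2πiz)`. -/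
noncomputable def framing (q₁ q₂ : ℂ) (u : Fin r → ℂ) (p : Fin s → ℂ) (z : ℂ) : ℂ :=
  (∏ m, (z - p m)) * ∏ α, (-(u α) * z) / ((z - u α) * (q₁ * q₂ * z - u α))

theorem integrand_eq {n : ℕ} (u : Fin r → ℂ) (p : Fin s → ℂ) (z : Fin n → ℂ) :
    integrand q₁ q₂ u p z = (∏ j, 1 / (2 * (π : ℂ) * Complex.I * z j)) *
      ((∏ j, framing q₁ q₂ u p (z j)) * interaction q₁ q₂ z) := by
  simp only [integrand, weight, framing, interaction, pairK, Finset.prod_mul_distrib]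
  ring

theorem framing_den_ne_zero (hq₁ : ‖q₁‖ < 1) {ρ : ℝ} {a z : ℂ} (ha : ‖a‖ < ρ)
    (ha₂ : ‖q₂‖ * ρ < ‖a‖) (hz : ‖z‖ = ρ) : (z - a) * (q₁ * q₂ * z - a) ≠ 0 := by
  refine mul_ne_zero (fun h => ?_) (fun h => ?_)
  · rw [← sub_eq_zero.1 h, hz] at ha
    exact ha.false
  · rw [← sub_eq_zero.1 h, norm_mul, norm_mul, hz] at ha₂
    have : 0 ≤ ‖q₂‖ * ρ := mul_nonneg (norm_nonneg _) (hz ▸ norm_nonneg z)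
    nlinarith

theorem continuous_framing_unitPt (hq₁ : ‖q₁‖ < 1) {u : Fin r → ℂ} (p : Fin s → ℂ) {ρ : ℝ}
    (hρ : 0 < ρ) (hu : ∀ α, ‖u α‖ < ρ) (hu₂ : ∀ α, ‖q₂‖ * ρ < ‖u α‖) :
    Continuous fun θ => framing q₁ q₂ u p (ρ * unitPt θ) := by
  have := continuous_unitPt
  unfold framing
  refine Continuous.mul (by fun_prop) (continuous_finsetProd _ fun α _ => ?_)
  refine Continuous.div (by fun_prop) (by fun_prop) fun θ => ?_
  exact framing_den_ne_zero hq₁ (hu α) (hu₂ α) (by simp [norm_unitPt, hρ.le])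

theorem torusMap_eq_unitPt {n : ℕ} (ρ : ℝ) (θ : Fin n → ℝ) :
    torusMap (0 : Fin n → ℂ) (fun _ => ρ) θ =
      fun j => ρ * unitPt (θ j : AddCircle (2 * π)) := by
  ext j
  simp [torusMap, unitPt_coe]

/-- The Jacobian of the parametrisation cancels `I * z j`, leaving 1/(2π) per variable, which is the
normalisation of Haar measure. The radius drops out of the interaction by homogeneity. -/
theorem torusIntegral_integrand (hq₁ : ‖q₁‖ < 1) (hq₂ : ‖q₂‖ < 1) {u : Fin r → ℂ}
    (p : Fin s → ℂ) {ρ : ℝ} (hρ : 0 < ρ) (hu : ∀ α, ‖u α‖ < ρ) (hu₂ : ∀ α, ‖q₂‖ * ρ < ‖u α‖)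
    (n : ℕ) :
    torusIntegral (integrand q₁ q₂ u p) (0 : Fin n → ℂ) (fun _ => ρ) =
      torusAvg q₁ q₂ n fun θ => framing q₁ q₂ u p (ρ * unitPt θ) := by
  have hρ0 : (ρ : ℂ) ≠ 0 := by exact_mod_cast hρ.ne'
  have hc := continuous_framing_unitPt hq₁ p hρ hu hu₂
  have hF : Continuous fun w : Fin n → AddCircle (2 * π) =>
      (∏ j, framing q₁ q₂ u p (ρ * unitPt (w j))) *
        interaction q₁ q₂ (fun j => unitPt (w j)) := by
    exact Continuous.mul (continuous_finsetProd _ fun j _ => hc.comp (continuous_apply j))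
      (continuous_interaction_unitPt hq₁ hq₂ n)
  have h2π : (2 * π : ℂ) ≠ 0 := by exact_mod_cast Real.two_pi_pos.ne'
  have key := setIntegral_Icc_torus _ hF
  rw [torusIntegral, torusAvg, ← mul_right_inj' (pow_ne_zero n h2π), ← key, ← integral_const_mul]
  refine integral_congr_ae (Eventually.of_forall fun θ => ?_)
  simp only [torusMap_eq_unitPt, integrand_eq, interaction_smul hρ0, smul_eq_mul]
  rw [← mul_assoc (∏ i : Fin n, (ρ * Complex.exp (θ i * Complex.I) * Complex.I : ℂ)),
    ← Finset.prod_mul_distrib]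
  have h1 : ∀ j, (ρ * Complex.exp (θ j * Complex.I) * Complex.I) *
      (1 / (2 * (π : ℂ) * Complex.I * (ρ * unitPt (θ j : AddCircle (2 * π))))) = (2 * π : ℂ)⁻¹ := by
    intro j
    rw [unitPt_coe]
    have := Complex.exp_ne_zero (θ j * Complex.I)
    have hpi : (π : ℂ) ≠ 0 := by exact_mod_cast Real.pi_ne_zero
    field_simp
  simp only [h1, Finset.prod_const, Finset.card_univ, Fintype.card_fin]
  rw [← mul_assoc, ← mul_pow, mul_inv_cancel₀ h2π, one_pow, one_mul]

theorem torusIntegrable_integrand (hq₁ : ‖q₁‖ < 1) (hq₂ : ‖q₂‖ < 1) {u : Fin r → ℂ}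
    (p : Fin s → ℂ) {ρ : ℝ} (hρ : 0 < ρ) (hu : ∀ α, ‖u α‖ < ρ) (hu₂ : ∀ α, ‖q₂‖ * ρ < ‖u α‖)
    (n : ℕ) :
    TorusIntegrable (integrand q₁ q₂ u p) (0 : Fin n → ℂ) (fun _ => ρ) := by
  have hρ0 : (ρ : ℂ) ≠ 0 := by exact_mod_cast hρ.ne'
  have hc := continuous_framing_unitPt hq₁ p hρ hu hu₂
  have hi := continuous_interaction_unitPt hq₁ hq₂ n
  have hu := continuous_unitPt
  have hpi : (π : ℂ) ≠ 0 := by exact_mod_cast Real.pi_ne_zero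
  have hF : Continuous fun w : Fin n → AddCircle (2 * π) =>
      (∏ j, 1 / (2 * (π : ℂ) * Complex.I * (ρ * unitPt (w j)))) *
      ((∏ j, framing q₁ q₂ u p (ρ * unitPt (w j))) *
        interaction q₁ q₂ (fun j => unitPt (w j))) := by
    refine Continuous.mul (continuous_finsetProd _ fun j _ => ?_)
      (Continuous.mul (continuous_finsetProd _ fun j _ => hc.comp (continuous_apply j)) hi)
    refine Continuous.div (by fun_prop) (by fun_prop) fun w => ?_
    simp [hpi, hρ0, unitPt_ne_zero]
  refine Continuous.integrableOn_Icc ?_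
  simp only [torusMap_eq_unitPt, integrand_eq, interaction_smul hρ0]
  exact hF.comp (f := fun (θ : Fin n → ℝ) j => (θ j : AddCircle (2 * π)))
    (continuous_pi fun j => (AddCircle.continuous_mk' _).comp (continuous_apply j))

end TorusIntegral

/-! ### Addable boxes of a Young diagram -/

section Corners

/-- The boxes that can be added to a Young diagram. -/
def IsCorner (A : YoungDiagram) (c : ℕ × ℕ) : Prop :=
  A.rowLen c.1 = c.2 ∧ A.colLen c.2 = c.1

theorem rowLen_le_card (A : YoungDiagram) (i : ℕ) : A.rowLen i ≤ A.card := by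
  rw [YoungDiagram.rowLen_eq_card]
  exact Finset.card_le_card (Finset.filter_subset _ _)

theorem colLen_le_card (A : YoungDiagram) (j : ℕ) : A.colLen j ≤ A.card := by
  rw [YoungDiagram.colLen_eq_card]
  exact Finset.card_le_card (Finset.filter_subset _ _)

theorem lt_card_of_mem {A : YoungDiagram} {c : ℕ × ℕ} (h : c ∈ A) :
    c.1 < A.card ∧ c.2 < A.card :=
  ⟨(YoungDiagram.mem_iff_lt_colLen.1 h).trans_le (colLen_le_card A _),
    (YoungDiagram.mem_iff_lt_rowLen.1 h).trans_le (rowLen_le_card A _)⟩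

theorem rowLen_eq_zero {A : YoungDiagram} {i : ℕ} (h : A.card ≤ i) : A.rowLen i = 0 := by
  by_contra h0
  have : (i, 0) ∈ A := YoungDiagram.mem_iff_lt_rowLen.2 (Nat.pos_of_ne_zero h0)
  exact (lt_card_of_mem this).1.not_ge h

/-- Given the row condition, the column condition says that the row above is strictly longer. In
this form the addable boxes can be listed by rows. -/
theorem isCorner_iff {A : YoungDiagram} {c : ℕ × ℕ} :
    IsCorner A c ↔ A.rowLen c.1 = c.2 ∧ (c.1 = 0 ∨ A.rowLen c.1 < A.rowLen (c.1 - 1)) := by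
  obtain ⟨i, j⟩ := c
  simp only [IsCorner]
  refine and_congr_right fun h1 => ?_
  have hnot : ¬ i < A.colLen j := by
    rw [← YoungDiagram.mem_iff_lt_colLen, YoungDiagram.mem_iff_lt_rowLen]
    omega
  rcases i with _ | i
  · simp only [true_or, iff_true]
    omega
  · have h2 : i < A.colLen j ↔ j < A.rowLen i := by
      rw [← YoungDiagram.mem_iff_lt_colLen, YoungDiagram.mem_iff_lt_rowLen]
    simp only [Nat.add_one_sub_one]
    omega

/-- The finite set of boxes that can be added. -/
def corners (A : YoungDiagram) : Finset (ℕ × ℕ) :=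
  ((Finset.range (A.card + 1)).filter fun i => i = 0 ∨ A.rowLen i < A.rowLen (i - 1)).image
    fun i => (i, A.rowLen i)

theorem mem_corners {A : YoungDiagram} {c : ℕ × ℕ} : c ∈ corners A ↔ IsCorner A c := by
  rw [isCorner_iff, corners, Finset.mem_image]
  constructor
  · rintro ⟨i, hi, rfl⟩
    exact ⟨rfl, (Finset.mem_filter.1 hi).2⟩
  · rintro ⟨h1, h2⟩
    refine ⟨c.1, Finset.mem_filter.2 ⟨Finset.mem_range.2 ?_, h2⟩, Prod.ext rfl h1⟩
    rcases h2 with h2 | h2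
    · omega
    · by_contra h
      rw [rowLen_eq_zero (i := c.1 - 1) (by omega)] at h2
      omega

theorem IsCorner.notMem {A : YoungDiagram} {c : ℕ × ℕ} (h : IsCorner A c) : c ∉ A := by
  intro hc
  have : c.2 < A.rowLen c.1 := YoungDiagram.mem_iff_lt_rowLen.1 hc
  exact this.ne' h.1

theorem IsCorner.mem_of_lt {A : YoungDiagram} {c d : ℕ × ℕ} (h : IsCorner A c) (hd : d ≤ c)
    (hne : d ≠ c) : d ∈ A := by
  obtain ⟨i, j⟩ := c
  obtain ⟨a, b⟩ := d
  obtain ⟨h1, h2⟩ := h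
  simp only at h1 h2
  simp only [Prod.mk_le_mk] at hd
  rcases hd.1.lt_or_eq with ha | rfl
  · exact A.up_left_mem le_rfl hd.2 (YoungDiagram.mem_iff_lt_colLen.2 (ha.trans_eq h2.symm))
  · rcases hd.2.lt_or_eq with hb | rfl
    · exact YoungDiagram.mem_iff_lt_rowLen.2 (hb.trans_eq h1.symm)
    · exact absurd rfl hne

open Classical in
/-- Adds the box `c` to `A`, if the result is a Young diagram. -/
noncomputable def addBox (A : YoungDiagram) (c : ℕ × ℕ) : YoungDiagram :=
  if h : IsLowerSet ((insert c A.cells : Finset (ℕ × ℕ)) : Set (ℕ × ℕ)) then ⟨insert c A.cells, h⟩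
  else A

theorem cells_addBox {A : YoungDiagram} {c : ℕ × ℕ} (h : IsCorner A c) :
    (addBox A c).cells = insert c A.cells := by
  have hl : IsLowerSet ((insert c A.cells : Finset (ℕ × ℕ)) : Set (ℕ × ℕ)) := by
    intro a b hab ha
    simp only [Finset.coe_insert, Set.mem_insert_iff, Finset.mem_coe] at ha ⊢
    rcases ha with rfl | ha
    · by_cases hb : b = a
      · exact Or.inl hb
      · exact Or.inr (h.mem_of_lt hab hb)
    · exact Or.inr (A.isLowerSet hab ha)
  rw [addBox, dif_pos hl]

theorem mem_addBox {A : YoungDiagram} {c d : ℕ × ℕ} (h : IsCorner A c) :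
    d ∈ addBox A c ↔ d = c ∨ d ∈ A := by
  rw [← YoungDiagram.mem_cells, cells_addBox h, Finset.mem_insert, YoungDiagram.mem_cells]

theorem prod_cells_addBox {M : Type*} [CommMonoid M] {A : YoungDiagram} {c : ℕ × ℕ}
    (h : IsCorner A c) (f : ℕ × ℕ → M) :
    ∏ d ∈ (addBox A c).cells, f d = f c * ∏ d ∈ A.cells, f d := by
  rw [cells_addBox h, Finset.prod_insert]
  exact h.notMem

theorem card_addBox {A : YoungDiagram} {c : ℕ × ℕ} (h : IsCorner A c) :
    (addBox A c).card = A.card + 1 := by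
  show (addBox A c).cells.card = _
  rw [cells_addBox h, Finset.card_insert_of_notMem h.notMem]

theorem rowLen_addBox {A : YoungDiagram} {c : ℕ × ℕ} (h : IsCorner A c) (i : ℕ) :
    (addBox A c).rowLen i = if i = c.1 then c.2 + 1 else A.rowLen i := by
  refine eq_of_forall_lt_iff fun b => ?_
  rw [← YoungDiagram.mem_iff_lt_rowLen, mem_addBox h, YoungDiagram.mem_iff_lt_rowLen, Prod.ext_iff]
  have := h.1
  split_ifs with hi
  · subst hi
    simp only [true_and]
    omega
  · simp [hi]

theorem colLen_addBox {A : YoungDiagram} {c : ℕ × ℕ} (h : IsCorner A c) (j : ℕ) :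
    (addBox A c).colLen j = if j = c.2 then c.1 + 1 else A.colLen j := by
  refine eq_of_forall_lt_iff fun b => ?_
  rw [← YoungDiagram.mem_iff_lt_colLen, mem_addBox h, YoungDiagram.mem_iff_lt_colLen, Prod.ext_iff]
  have := h.2
  split_ifs with hi
  · subst hi
    simp only [and_true]
    omega
  · simp [hi]

end Corners

/-! ### Telescoping products of cross ratios -/

section Telescoping

/-- Factors in the numerator, at the ends of the rows above row `i` and of the columns below. -/
def rimNum (B : YoungDiagram) (i : ℕ) (F : ℕ → ℕ → ℂ) : ℂ :=
  (∏ a ∈ Finset.range i, F (a + 1) (B.rowLen a)) *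
    ∏ b ∈ Finset.range (B.rowLen i), F (B.colLen b) (b + 1)

/-- Factors in the denominator, at the ends of the rows above row `i` and of the columns below. -/
def rimDen (B : YoungDiagram) (i : ℕ) (F : ℕ → ℕ → ℂ) : ℂ :=
  (∏ a ∈ Finset.range i, F a (B.rowLen a)) *
    ∏ b ∈ Finset.range (B.rowLen i), F (B.colLen b) b

/-- The cross ratio of a box. -/
noncomputable def crossRatio (F : ℕ → ℕ → ℂ) (c : ℕ × ℕ) : ℂ :=
  (F c.1 c.2 * F (c.1 + 1) (c.2 + 1)) / (F (c.1 + 1) c.2 * F c.1 (c.2 + 1))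

theorem prod_cells_split {M : Type*} [CommMonoid M] (B : YoungDiagram) (i : ℕ)
    (f : ℕ × ℕ → M) :
    ∏ c ∈ B.cells, f c = (∏ a ∈ Finset.range i, ∏ b ∈ Finset.range (B.rowLen a), f (a, b)) *
      ∏ b ∈ Finset.range (B.rowLen i), ∏ a ∈ Finset.Ico i (B.colLen b), f (a, b) := by
  rw [← Finset.prod_filter_mul_prod_filter_not B.cells (fun c => c.1 < i)]
  congr 1
  · refine Finset.prod_finset_product _ _ _ fun c => ?_
    rw [Finset.mem_filter, YoungDiagram.mem_cells, Finset.mem_range, Finset.mem_range,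
      ← YoungDiagram.mem_iff_lt_rowLen, and_comm]
  · refine Finset.prod_finset_product_right _ _ _ fun c => ?_
    obtain ⟨a, b⟩ := c
    rw [Finset.mem_filter, YoungDiagram.mem_cells, Finset.mem_range, Finset.mem_Ico,
      ← YoungDiagram.mem_iff_lt_rowLen, ← YoungDiagram.mem_iff_lt_colLen, not_lt]
    constructor
    · rintro ⟨h1, h2⟩
      exact ⟨B.up_left_mem h2 le_rfl h1, h2, h1⟩
    · rintro ⟨_, h2, h1⟩
      exact ⟨h1, h2⟩

/-- Cross ratios telescope along rows above row `i`, and along columns from row `i` downwards; the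
contributions of the starting ends collapse to `F 0 0 / F i (B.rowLen i)`. The freedom in `i`
matters: a row below the diagram exposes the addable boxes, while the row of an addable box isolates
the factor that vanishes there and matches the change of `N`. -/
theorem prod_crossRatio_div {B : YoungDiagram} {i D : ℕ} {F : ℕ → ℕ → ℂ}
    (hF : ∀ a ≤ D, ∀ b ≤ D, F a b ≠ 0) (hB : B.card ≤ D) (hi : i ≤ D) :
    (∏ c ∈ B.cells, crossRatio F c) / F 0 0 =
      rimNum B i F / (F i (B.rowLen i) * rimDen B i F) := by
  have hr : ∀ a, B.rowLen a ≤ D := fun a => (rowLen_le_card B a).trans hB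
  have hcl : ∀ b, B.colLen b ≤ D := fun b => (colLen_le_card B b).trans hB
  have hrow : ∀ a < i, ∀ n ≤ D, ∏ b ∈ Finset.range n, crossRatio F (a, b) =
      (F a 0 / F (a + 1) 0) * (F (a + 1) n / F a n) := by
    intro a ha n
    induction n with
    | zero =>
      intro _
      have h1 := hF a (by omega) 0 (by omega)
      have h2 := hF (a + 1) (by omega) 0 (by omega)
      rw [Finset.prod_range_zero]
      field_simp
    | succ n ih =>
      intro hn
      have h1 := hF a (by omega) n (by omega)
      have h2 := hF (a + 1) (by omega) n (by omega)
      rw [Finset.prod_range_succ, ih (by omega), crossRatio]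
      simp only
      field_simp
  have hcol : ∀ b < D, ∀ n, i ≤ n → n ≤ D → ∏ a ∈ Finset.Ico i n, crossRatio F (a, b) =
      (F i b / F i (b + 1)) * (F n (b + 1) / F n b) := by
    intro b hb n hn
    induction n, hn using Nat.le_induction with
    | base =>
      intro _
      have h1 := hF i hi b (by omega)
      have h2 := hF i hi (b + 1) (by omega)
      rw [Finset.Ico_self, Finset.prod_empty]
      field_simp
    | succ n hin ih =>
      intro hn
      have h1 := hF n (by omega) b (by omega)
      have h2 := hF n (by omega) (b + 1) (by omega)
      rw [Finset.prod_Ico_succ_top hin, ih (by omega), crossRatio]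
      simp only
      field_simp
  rw [prod_cells_split B i]
  have e1 : ∏ a ∈ Finset.range i, ∏ b ∈ Finset.range (B.rowLen a), crossRatio F (a, b) =
      (F 0 0 / F i 0) * ((∏ a ∈ Finset.range i, F (a + 1) (B.rowLen a)) /
        ∏ a ∈ Finset.range i, F a (B.rowLen a)) := by
    rw [Finset.prod_congr rfl fun a ha => hrow a (Finset.mem_range.1 ha) _ (hr a),
      Finset.prod_mul_distrib, Finset.prod_div_distrib, Finset.prod_div_distrib]
    congr 1
    have h1 := Finset.prod_range_succ (fun a => F a 0) i
    rw [Finset.prod_range_succ'] at h1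
    have h2 : ∏ a ∈ Finset.range i, F (a + 1) 0 ≠ 0 := Finset.prod_ne_zero_iff.2 fun a ha =>
      hF _ (by have := Finset.mem_range.1 ha; omega) _ (by omega)
    rw [div_eq_div_iff h2 (hF i hi 0 (by omega)), ← h1, mul_comm]
  have e2 : ∏ b ∈ Finset.range (B.rowLen i), ∏ a ∈ Finset.Ico i (B.colLen b),
      crossRatio F (a, b) = (F i 0 / F i (B.rowLen i)) *
        ((∏ b ∈ Finset.range (B.rowLen i), F (B.colLen b) (b + 1)) /
        ∏ b ∈ Finset.range (B.rowLen i), F (B.colLen b) b) := by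
    have hlt : ∀ b ∈ Finset.range (B.rowLen i), b < D ∧ i ≤ B.colLen b := fun b hb =>
      ⟨(Finset.mem_range.1 hb).trans_le (hr i),
        (YoungDiagram.mem_iff_lt_colLen.1
          (YoungDiagram.mem_iff_lt_rowLen.2 (Finset.mem_range.1 hb))).le⟩
    rw [Finset.prod_congr rfl fun b hb => hcol b (hlt b hb).1 _ (hlt b hb).2 (hcl b),
      Finset.prod_mul_distrib, Finset.prod_div_distrib, Finset.prod_div_distrib]
    congr 1
    have h1 := Finset.prod_range_succ (fun b => F i b) (B.rowLen i)
    rw [Finset.prod_range_succ'] at h1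
    have h2 : ∏ b ∈ Finset.range (B.rowLen i), F i (b + 1) ≠ 0 :=
      Finset.prod_ne_zero_iff.2 fun b hb => hF _ hi _ (hlt b hb).1
    rw [div_eq_div_iff h2 (hF i hi _ (hr i)), ← h1, mul_comm]
  have h00 := hF 0 (by omega) 0 (by omega)
  have hi0 := hF i hi 0 (by omega)
  rw [e1, e2, rimNum, rimDen, ← div_div]
  field_simp

/-- Factors at the boxes diagonally behind the removable ones. -/
def innerNum (B : YoungDiagram) (F : ℕ → ℕ → ℂ) : ℂ :=
  ∏ a ∈ (Finset.range B.card).filter fun a => B.rowLen (a + 1) < B.rowLen a, F (a + 1) (B.rowLen a)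

theorem prod_corners (B : YoungDiagram) (F : ℕ → ℕ → ℂ) :
    ∏ c ∈ corners B, F c.1 c.2 = F 0 (B.rowLen 0) *
      ∏ a ∈ (Finset.range B.card).filter fun a => B.rowLen (a + 1) < B.rowLen a,
        F (a + 1) (B.rowLen (a + 1)) := by
  rw [corners, Finset.prod_image fun _ _ _ _ h => (Prod.mk.inj h).1, Finset.prod_filter,
    Finset.prod_range_succ', Finset.prod_filter, mul_comm]
  simp

/-- With the split below the whole diagram only row ends remain. Consecutive rows of equal length
cancel, so the denominator keeps the addable boxes alone. -/
theorem prod_crossRatio_div_eq_corners {B : YoungDiagram} {D : ℕ} {F : ℕ → ℕ → ℂ}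
    (hF : ∀ a ≤ D, ∀ b ≤ D, F a b ≠ 0) (hB : B.card ≤ D) :
    (∏ c ∈ B.cells, crossRatio F c) / F 0 0 =
      innerNum B F / ∏ c ∈ corners B, F c.1 c.2 := by
  have hr : ∀ a, B.rowLen a ≤ D := fun a => (rowLen_le_card B a).trans hB
  rw [prod_crossRatio_div hF hB hB, rimNum, rimDen, rowLen_eq_zero le_rfl, Finset.range_zero,
    Finset.prod_empty, Finset.prod_empty, mul_one, mul_one, prod_corners, innerNum]
  have hden : F B.card 0 * ∏ a ∈ Finset.range B.card, F a (B.rowLen a) =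
      F 0 (B.rowLen 0) * ∏ a ∈ Finset.range B.card, F (a + 1) (B.rowLen (a + 1)) := by
    have := Finset.prod_range_succ (fun a => F a (B.rowLen a)) B.card
    rw [Finset.prod_range_succ', rowLen_eq_zero le_rfl] at this
    rw [mul_comm, ← this, mul_comm]
  rw [hden, ← Finset.prod_filter_mul_prod_filter_not (Finset.range B.card)
    (fun a => B.rowLen (a + 1) < B.rowLen a) (fun a => F (a + 1) (B.rowLen a)),
    ← Finset.prod_filter_mul_prod_filter_not (Finset.range B.card)
    (fun a => B.rowLen (a + 1) < B.rowLen a) (fun a => F (a + 1) (B.rowLen (a + 1)))]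
  have heq : ∏ a ∈ (Finset.range B.card).filter fun a => ¬ B.rowLen (a + 1) < B.rowLen a,
      F (a + 1) (B.rowLen a) =
      ∏ a ∈ (Finset.range B.card).filter fun a => ¬ B.rowLen (a + 1) < B.rowLen a,
      F (a + 1) (B.rowLen (a + 1)) := by
    refine Finset.prod_congr rfl fun a ha => ?_
    have h1 := (Finset.mem_filter.1 ha).2
    have h2 := B.rowLen_anti a (a + 1) (by omega)
    rw [show B.rowLen (a + 1) = B.rowLen a by omega]
  have hne : ∏ a ∈ (Finset.range B.card).filter fun a => ¬ B.rowLen (a + 1) < B.rowLen a,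
      F (a + 1) (B.rowLen (a + 1)) ≠ 0 := Finset.prod_ne_zero_iff.2 fun a ha => by
    have h1 := Finset.mem_range.1 (Finset.mem_filter.1 ha).1
    exact hF _ (by omega) _ (hr _)
  rw [heq, ← mul_assoc, mul_div_mul_right _ _ hne]

end Telescoping

/-! ### How the factors of the denominator change when a box is added -/

section PairFactor

theorem prod_cells_row {M : Type*} [CommMonoid M] (B : YoungDiagram) (i : ℕ) (f : ℕ × ℕ → M) :
    ∏ c ∈ B.cells, f c = (∏ b ∈ Finset.range (B.rowLen i), f (i, b)) *
      ∏ c ∈ B.cells.filter fun c => ¬ c.1 = i, f c := by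
  rw [← Finset.prod_filter_mul_prod_filter_not B.cells (fun c => c.1 = i)]
  congr 1
  have : B.cells.filter (fun c => c.1 = i) = {i} ×ˢ Finset.range (B.rowLen i) :=
    YoungDiagram.row_eq_prod
  rw [this, Finset.prod_product, Finset.prod_singleton]

theorem prod_cells_col {M : Type*} [CommMonoid M] (B : YoungDiagram) (j : ℕ) (f : ℕ × ℕ → M) :
    ∏ c ∈ B.cells, f c = (∏ a ∈ Finset.range (B.colLen j), f (a, j)) *
      ∏ c ∈ B.cells.filter fun c => ¬ c.2 = j, f c := by
  rw [← Finset.prod_filter_mul_prod_filter_not B.cells (fun c => c.2 = j)]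
  congr 1
  have : B.cells.filter (fun c => c.2 = j) = Finset.range (B.colLen j) ×ˢ {j} :=
    YoungDiagram.col_eq_prod
  rw [this, Finset.prod_product]
  simp

/-- A quotient of products that differ in one row only, cross-multiplied because the factors may
vanish. -/
theorem prod_cells_exchange_row {M : Type*} [CommMonoid M] (B : YoungDiagram) (i : ℕ)
    {f g : ℕ × ℕ → M} (h : ∀ c, c.1 ≠ i → f c = g c) :
    (∏ c ∈ B.cells, f c) * ∏ b ∈ Finset.range (B.rowLen i), g (i, b) =
      (∏ c ∈ B.cells, g c) * ∏ b ∈ Finset.range (B.rowLen i), f (i, b) := by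
  rw [prod_cells_row B i f, prod_cells_row B i g,
    Finset.prod_congr rfl fun c hc => h c (Finset.mem_filter.1 hc).2, mul_right_comm]
  rw [mul_comm (∏ b ∈ Finset.range (B.rowLen i), f (i, b)), mul_right_comm]

theorem prod_cells_exchange_col {M : Type*} [CommMonoid M] (B : YoungDiagram) (j : ℕ)
    {f g : ℕ × ℕ → M} (h : ∀ c, c.2 ≠ j → f c = g c) :
    (∏ c ∈ B.cells, f c) * ∏ a ∈ Finset.range (B.colLen j), g (a, j) =
      (∏ c ∈ B.cells, g c) * ∏ a ∈ Finset.range (B.colLen j), f (a, j) := by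
  rw [prod_cells_col B j f, prod_cells_col B j g,
    Finset.prod_congr rfl fun c hc => h c (Finset.mem_filter.1 hc).2, mul_right_comm]
  rw [mul_comm (∏ a ∈ Finset.range (B.colLen j), f (a, j)), mul_right_comm]

/-- The factor `N_{α,β}` as a function of the ratio `w = u_α / u_β` and of the two diagrams. -/
noncomputable def pairN (q₁ q₂ w : ℂ) (A B : YoungDiagram) : ℂ :=
  (∏ s ∈ A.cells, (1 - w * q₁ ^ (leg A s + 1) * q₂ ^ (-arm B s))) *
    ∏ t ∈ B.cells, (1 - w * q₁ ^ (-leg B t) * q₂ ^ (arm A t + 1))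

theorem N_eq_pairN (q₁ q₂ : ℂ) {r : ℕ} (u : Fin r → ℂ) (Y : Fin r → YoungDiagram) (α β : Fin r) :
    N q₁ q₂ u Y α β = pairN q₁ q₂ (u α / u β) (Y α) (Y β) := rfl

variable (q₁ q₂ w : ℂ)

/-- The factors that change when the box `c` is added to the first diagram. -/
noncomputable def fstFactor (c : ℕ × ℕ) (a b : ℕ) : ℂ :=
  1 - w * q₁ ^ ((c.1 : ℤ) + 1 - a) * q₂ ^ ((c.2 : ℤ) + 1 - b)

/-- The factors that change when the box `c` is added to the second diagram. -/
noncomputable def sndFactor (c : ℕ × ℕ) (a b : ℕ) : ℂ :=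
  1 - w * q₁ ^ ((a : ℤ) - c.1) * q₂ ^ ((b : ℤ) - c.2)

variable {A : YoungDiagram} {c : ℕ × ℕ}

/-- The new box changes legs of the first diagram only in its column and arms only in its row, and
contributes one factor of its own. The factors concerned sit at the row and column ends of `B`, as
in the telescoped cross ratios. The identity is cross-multiplied, so no nonvanishing is needed. -/
theorem pairN_addBox_left (hc : IsCorner A c) (B : YoungDiagram) :
    pairN q₁ q₂ w (addBox A c) B * rimNum B c.1 (fstFactor q₁ q₂ w c) =
      pairN q₁ q₂ w A B * (fstFactor q₁ q₂ w c c.1 (B.rowLen c.1) *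
        rimDen B c.1 (fstFactor q₁ q₂ w c)) := by
  obtain ⟨i, j⟩ := c
  have h1 := hc.1
  have h2 := hc.2
  have hleg := colLen_addBox hc
  have harm := rowLen_addBox hc
  simp only at h1 h2 hleg harm
  have e1 := prod_cells_exchange_col A j
    (f := fun s => 1 - w * q₁ ^ (leg (addBox A (i, j)) s + 1) * q₂ ^ (-arm B s))
    (g := fun s => 1 - w * q₁ ^ (leg A s + 1) * q₂ ^ (-arm B s)) (by
      intro s hs
      simp only [leg, hleg, if_neg hs])
  have e2 := prod_cells_exchange_row B i
    (f := fun t => 1 - w * q₁ ^ (-leg B t) * q₂ ^ (arm (addBox A (i, j)) t + 1))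
    (g := fun t => 1 - w * q₁ ^ (-leg B t) * q₂ ^ (arm A t + 1)) (by
      intro s hs
      simp only [arm, harm, if_neg hs])
  have f1 : ∀ a : ℕ, 1 - w * q₁ ^ (leg (addBox A (i, j)) (a, j) + 1) * q₂ ^ (-arm B (a, j)) =
      fstFactor q₁ q₂ w (i, j) a (B.rowLen a) := by
    intro a
    simp only [leg, arm, hleg, fstFactor, if_true]
    congr 3 <;> push_cast <;> ring_nf
  have f2 : ∀ a : ℕ, 1 - w * q₁ ^ (leg A (a, j) + 1) * q₂ ^ (-arm B (a, j)) =
      fstFactor q₁ q₂ w (i, j) (a + 1) (B.rowLen a) := by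
    intro a
    simp only [leg, arm, h2, fstFactor]
    congr 3 <;> push_cast <;> ring_nf
  have f3 : ∀ b : ℕ, 1 - w * q₁ ^ (-leg B (i, b)) * q₂ ^ (arm (addBox A (i, j)) (i, b) + 1) =
      fstFactor q₁ q₂ w (i, j) (B.colLen b) b := by
    intro b
    simp only [leg, arm, harm, fstFactor, if_true]
    congr 3 <;> push_cast <;> ring_nf
  have f4 : ∀ b : ℕ, 1 - w * q₁ ^ (-leg B (i, b)) * q₂ ^ (arm A (i, b) + 1) =
      fstFactor q₁ q₂ w (i, j) (B.colLen b) (b + 1) := by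
    intro b
    simp only [leg, arm, h1, fstFactor]
    congr 3 <;> push_cast <;> ring_nf
  simp only [f1, f2, f3, f4, h2] at e1 e2
  simp only [pairN, rimNum, rimDen]
  rw [prod_cells_addBox hc, f1]
  linear_combination (fstFactor q₁ q₂ w (i, j) i (B.rowLen i) *
      (∏ t ∈ B.cells, (1 - w * q₁ ^ (-leg B t) * q₂ ^ (arm (addBox A (i, j)) t + 1))) *
      ∏ b ∈ Finset.range (B.rowLen i), fstFactor q₁ q₂ w (i, j) (B.colLen b) (b + 1)) * e1 +
    (fstFactor q₁ q₂ w (i, j) i (B.rowLen i) *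
      (∏ s ∈ A.cells, (1 - w * q₁ ^ (leg A s + 1) * q₂ ^ (-arm B s))) *
      ∏ a ∈ Finset.range i, fstFactor q₁ q₂ w (i, j) a (B.rowLen a)) * e2

/-- The same count as in `pairN_addBox_left`, with the column acting on the second product of
`pairN` and the row on the first. -/
theorem pairN_addBox_right (hc : IsCorner A c) (B : YoungDiagram) :
    pairN q₁ q₂ w B (addBox A c) * rimNum B c.1 (sndFactor q₁ q₂ w c) =
      pairN q₁ q₂ w B A * (sndFactor q₁ q₂ w c c.1 (B.rowLen c.1) *
        rimDen B c.1 (sndFactor q₁ q₂ w c)) := by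
  obtain ⟨i, j⟩ := c
  have h1 := hc.1
  have h2 := hc.2
  have hleg := colLen_addBox hc
  have harm := rowLen_addBox hc
  simp only at h1 h2 hleg harm
  have e1 := prod_cells_exchange_col A j
    (f := fun t => 1 - w * q₁ ^ (-leg (addBox A (i, j)) t) * q₂ ^ (arm B t + 1))
    (g := fun t => 1 - w * q₁ ^ (-leg A t) * q₂ ^ (arm B t + 1)) (by
      intro s hs
      simp only [leg, hleg, if_neg hs])
  have e2 := prod_cells_exchange_row B i
    (f := fun s => 1 - w * q₁ ^ (leg B s + 1) * q₂ ^ (-arm (addBox A (i, j)) s))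
    (g := fun s => 1 - w * q₁ ^ (leg B s + 1) * q₂ ^ (-arm A s)) (by
      intro s hs
      simp only [arm, harm, if_neg hs])
  have f1 : ∀ a : ℕ, 1 - w * q₁ ^ (-leg (addBox A (i, j)) (a, j)) * q₂ ^ (arm B (a, j) + 1) =
      sndFactor q₁ q₂ w (i, j) a (B.rowLen a) := by
    intro a
    simp only [leg, arm, hleg, sndFactor, if_true]
    congr 3 <;> push_cast <;> ring_nf
  have f2 : ∀ a : ℕ, 1 - w * q₁ ^ (-leg A (a, j)) * q₂ ^ (arm B (a, j) + 1) =
      sndFactor q₁ q₂ w (i, j) (a + 1) (B.rowLen a) := by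
    intro a
    simp only [leg, arm, h2, sndFactor]
    congr 3 <;> push_cast <;> ring_nf
  have f3 : ∀ b : ℕ, 1 - w * q₁ ^ (leg B (i, b) + 1) * q₂ ^ (-arm (addBox A (i, j)) (i, b)) =
      sndFactor q₁ q₂ w (i, j) (B.colLen b) b := by
    intro b
    simp only [leg, arm, harm, sndFactor, if_true]
    congr 3 <;> push_cast <;> ring_nf
  have f4 : ∀ b : ℕ, 1 - w * q₁ ^ (leg B (i, b) + 1) * q₂ ^ (-arm A (i, b)) =
      sndFactor q₁ q₂ w (i, j) (B.colLen b) (b + 1) := by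
    intro b
    simp only [leg, arm, h1, sndFactor]
    congr 3 <;> push_cast <;> ring_nf
  simp only [f1, f2, f3, f4, h2] at e1 e2
  simp only [pairN, rimNum, rimDen]
  rw [prod_cells_addBox hc, f1]
  linear_combination (sndFactor q₁ q₂ w (i, j) i (B.rowLen i) *
      (∏ s ∈ B.cells, (1 - w * q₁ ^ (leg B s + 1) * q₂ ^ (-arm (addBox A (i, j)) s))) *
      ∏ b ∈ Finset.range (B.rowLen i), sndFactor q₁ q₂ w (i, j) (B.colLen b) (b + 1)) * e1 +
    (sndFactor q₁ q₂ w (i, j) i (B.rowLen i) *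
      (∏ t ∈ A.cells, (1 - w * q₁ ^ (-leg A t) * q₂ ^ (arm B t + 1))) *
      ∏ a ∈ Finset.range i, sndFactor q₁ q₂ w (i, j) a (B.rowLen a)) * e2

/-- The ratio of end factors around row `i`. -/
noncomputable def rimRatio (B : YoungDiagram) (i : ℕ) (F : ℕ → ℕ → ℂ) : ℂ :=
  rimNum B i F / (F i (B.rowLen i) * rimDen B i F)

/-- All cross ratios of `K` are 1, so `prod_crossRatio_div` evaluates its end factors to `1 / K 0
0`. This removes the monomials by which linear factors in z differ from factors of `N`. -/
theorem rimRatio_mul {B : YoungDiagram} {i : ℕ} {K : ℕ → ℕ → ℂ} (hK : ∀ a b, K a b ≠ 0)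
    (hcr : ∀ a b, K a b * K (a + 1) (b + 1) = K (a + 1) b * K a (b + 1)) (F : ℕ → ℕ → ℂ) :
    rimRatio B i (fun a b => K a b * F a b) = rimRatio B i F / K 0 0 := by
  have h1 := prod_crossRatio_div (B := B) (i := i) (D := max B.card i) (F := K)
    (fun a _ b _ => hK a b) (le_max_left _ _) (le_max_right _ _)
  have h2 : ∀ c ∈ B.cells, crossRatio K c = 1 := fun c _ => by
    rw [crossRatio, hcr]
    exact div_self (mul_ne_zero (hK _ _) (hK _ _))
  rw [Finset.prod_congr rfl h2, Finset.prod_const_one] at h1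
  rw [div_eq_mul_one_div (rimRatio B i F), h1, rimRatio, rimRatio]
  simp only [rimNum, rimDen, Finset.prod_mul_distrib]
  rw [div_mul_div_comm]
  congr 1 <;> ring

theorem rimNum_const_mul {B : YoungDiagram} {i : ℕ} (k : ℂ) (F : ℕ → ℕ → ℂ) :
    rimNum B i (fun a b => k * F a b) = k ^ (i + B.rowLen i) * rimNum B i F := by
  simp only [rimNum, Finset.prod_mul_distrib, Finset.prod_const, Finset.card_range]
  ring

theorem rimDen_const_mul {B : YoungDiagram} {i : ℕ} (k : ℂ) (F : ℕ → ℕ → ℂ) :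
    rimDen B i (fun a b => k * F a b) = k ^ (i + B.rowLen i) * rimDen B i F := by
  simp only [rimDen, Finset.prod_mul_distrib, Finset.prod_const, Finset.card_range]
  ring

/-- Only the column of the new box enters the product. Needed for the diagonal factor, where both
diagrams grow. -/
theorem rimNum_addBox (hc : IsCorner A c) (F : ℕ → ℕ → ℂ) :
    rimNum (addBox A c) c.1 F = rimNum A c.1 F * F (c.1 + 1) (c.2 + 1) := by
  have h1 := hc.1
  simp only [rimNum, rowLen_addBox hc, colLen_addBox hc, if_true, h1, Finset.prod_range_succ]
  rw [← mul_assoc]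
  congr 2
  · exact Finset.prod_congr rfl fun a ha => by rw [if_neg (Finset.mem_range.1 ha).ne]
  · exact Finset.prod_congr rfl fun b hb => by rw [if_neg (Finset.mem_range.1 hb).ne]

theorem rimDen_addBox (hc : IsCorner A c) (F : ℕ → ℕ → ℂ) :
    rimDen (addBox A c) c.1 F = rimDen A c.1 F * F (c.1 + 1) c.2 := by
  have h1 := hc.1
  simp only [rimDen, rowLen_addBox hc, colLen_addBox hc, if_true, h1, Finset.prod_range_succ]
  rw [← mul_assoc]
  congr 2
  · exact Finset.prod_congr rfl fun a ha => by rw [if_neg (Finset.mem_range.1 ha).ne]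
  · exact Finset.prod_congr rfl fun b hb => by rw [if_neg (Finset.mem_range.1 hb).ne]

end PairFactor

/-! ### Poles and residues of the one-body function -/

section OneBodyFunction

variable (q₁ q₂ : ℂ) {r s : ℕ} (u : Fin r → ℂ) (p : Fin s → ℂ)

/-- The linear factors `z - v q₁^a q₂^b`. -/
noncomputable def linF (v z : ℂ) (a b : ℕ) : ℂ := z - v * q₁ ^ a * q₂ ^ b

/-- The boxes that can be added to a tuple of Young diagrams. -/
def tupleCorners (Y : Fin r → YoungDiagram) : Finset (Fin r × (ℕ × ℕ)) :=
  Finset.univ.biUnion fun α => (corners (Y α)).image (Prod.mk α)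

theorem mem_tupleCorners {Y : Fin r → YoungDiagram} {b : Fin r × (ℕ × ℕ)} :
    b ∈ tupleCorners Y ↔ IsCorner (Y b.1) b.2 := by
  obtain ⟨α, c⟩ := b
  simp [tupleCorners, mem_corners]

theorem prod_tupleCorners (Y : Fin r → YoungDiagram) (f : Fin r × (ℕ × ℕ) → ℂ) :
    ∏ b ∈ tupleCorners Y, f b = ∏ α, ∏ c ∈ corners (Y α), f (α, c) :=
  Finset.prod_finset_product _ _ _ fun b => by simp [mem_tupleCorners, mem_corners]

/-- The position of a box of a tuple. -/
noncomputable def pt (b : Fin r × (ℕ × ℕ)) : ℂ := boxPoint q₁ q₂ u b.1 b.2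

/-- The one-body function of the remaining variables in the presence of the boxes of `Y`. -/
noncomputable def oneBody (Y : Fin r → YoungDiagram) (z : ℂ) : ℂ :=
  framing q₁ q₂ u p z * ∏ β, ∏ c ∈ (Y β).cells,
    pairK q₁ q₂ z (boxPoint q₁ q₂ u β c) * pairK q₁ q₂ (boxPoint q₁ q₂ u β c) z

/-- The points where the linear factors of boxes of bounded size vanish. -/
def badSet (D : ℕ) : Set ℂ :=
  {z | ∃ β : Fin r, ∃ a ≤ D, ∃ b ≤ D,
    linF q₁ q₂ (u β) z a b = 0 ∨ linF q₁ q₂ (u β) (q₁ * q₂ * z) a b = 0}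

/-- The holomorphic part of the one-body function on the disc of radius `R`. -/
noncomputable def regPart (Y : Fin r → YoungDiagram) (R : ℝ) (z : ℂ) : ℂ :=
  (∏ m, (z - p m)) * z ^ (r - 1) * (∏ β, innerNum (Y β) (linF q₁ q₂ (u β) z)) *
    (∏ b ∈ (tupleCorners Y).filter fun b => ¬ ‖pt q₁ q₂ u b‖ < R, (z - pt q₁ q₂ u b))⁻¹ *
    (∏ β, -u β) * (∏ β, innerNum (Y β) (linF q₁ q₂ (u β) (q₁ * q₂ * z))) *
    (∏ b ∈ tupleCorners Y, (q₁ * q₂ * z - pt q₁ q₂ u b))⁻¹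

/-- The residue factor at an addable box, from the ends of rows and columns. -/
noncomputable def resFun (Y : Fin r → YoungDiagram) (b : Fin r × (ℕ × ℕ)) (z : ℂ) : ℂ :=
  ((rimNum (Y b.1) b.2.1 (linF q₁ q₂ (u b.1) z) / rimDen (Y b.1) b.2.1 (linF q₁ q₂ (u b.1) z)) *
      (-u b.1 * rimRatio (Y b.1) b.2.1 (linF q₁ q₂ (u b.1) (q₁ * q₂ * z)))) *
    ∏ β ∈ Finset.univ.erase b.1, (z * rimRatio (Y β) b.2.1 (linF q₁ q₂ (u β) z)) *
      (-u β * rimRatio (Y β) b.2.1 (linF q₁ q₂ (u β) (q₁ * q₂ * z)))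

variable {q₁ q₂ u p}

theorem badSet_finite (hq₁ : q₁ ≠ 0) (hq₂ : q₂ ≠ 0) (D : ℕ) : (badSet q₁ q₂ u D).Finite := by
  have hsub : badSet q₁ q₂ u D ⊆ ⋃ β : Fin r, ⋃ a ∈ Set.Iic D, ⋃ b ∈ Set.Iic D,
      ({u β * q₁ ^ a * q₂ ^ b, u β * q₁ ^ a * q₂ ^ b / (q₁ * q₂)} : Set ℂ) := by
    rintro z ⟨β, a, ha, b, hb, h⟩
    simp only [Set.mem_iUnion]
    refine ⟨β, a, ha, b, hb, ?_⟩
    rcases h with h | h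
    · exact Or.inl (sub_eq_zero.1 h)
    · right
      rw [Set.mem_singleton_iff, ← sub_eq_zero.1 h]
      field_simp
  refine Set.Finite.subset ?_ hsub
  exact Set.finite_iUnion fun β => (Set.finite_Iic D).biUnion fun a _ =>
    (Set.finite_Iic D).biUnion fun b _ => Set.toFinite _

theorem oneBody_bot (z : ℂ) : oneBody q₁ q₂ u p (fun _ => ⊥) z = framing q₁ q₂ u p z := by
  simp [oneBody]

/-- Adds one box to a tuple. -/
noncomputable def addTuple (Y : Fin r → YoungDiagram) (b : Fin r × (ℕ × ℕ)) :
    Fin r → YoungDiagram :=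
  Function.update Y b.1 (addBox (Y b.1) b.2)

theorem prod_addTuple {M : Type*} [CommMonoid M] {Y : Fin r → YoungDiagram}
    {b : Fin r × (ℕ × ℕ)} (hb : IsCorner (Y b.1) b.2) (f : Fin r → ℕ × ℕ → M) :
    ∏ β, ∏ c ∈ (addTuple Y b β).cells, f β c = f b.1 b.2 * ∏ β, ∏ c ∈ (Y β).cells, f β c := by
  rw [← Finset.mul_prod_erase _ _ (Finset.mem_univ b.1),
    ← Finset.mul_prod_erase Finset.univ (fun β => ∏ c ∈ (Y β).cells, f β c)
      (Finset.mem_univ b.1), addTuple, Function.update_self, prod_cells_addBox hb, mul_assoc]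
  congr 2
  exact Finset.prod_congr rfl fun β hβ => by
    rw [Function.update_of_ne (Finset.ne_of_mem_erase hβ)]

theorem oneBody_addTuple {Y : Fin r → YoungDiagram} {b : Fin r × (ℕ × ℕ)}
    (hb : IsCorner (Y b.1) b.2) (z : ℂ) :
    oneBody q₁ q₂ u p (addTuple Y b) z = oneBody q₁ q₂ u p Y z *
      (pairK q₁ q₂ z (pt q₁ q₂ u b) * pairK q₁ q₂ (pt q₁ q₂ u b) z) := by
  rw [oneBody, prod_addTuple hb, oneBody, pt]
  ring

/-- Both orders of the pair interaction with a box are cross ratios of linear factors, one in z and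
one in q₁q₂z. The denominator of the framing supplies exactly the divisions by `linF` at the origin
that the telescoping formula requires. -/
theorem oneBody_eq_prod_crossRatio (hq₁ : q₁ ≠ 0) (hq₂ : q₂ ≠ 0) (Y : Fin r → YoungDiagram)
    (z : ℂ) : oneBody q₁ q₂ u p Y z = (∏ m, (z - p m)) *
      ∏ β, (z * ((∏ c ∈ (Y β).cells, crossRatio (linF q₁ q₂ (u β) z) c) /
          linF q₁ q₂ (u β) z 0 0)) *
        (-u β * ((∏ c ∈ (Y β).cells, crossRatio (linF q₁ q₂ (u β) (q₁ * q₂ * z)) c) /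
          linF q₁ q₂ (u β) (q₁ * q₂ * z) 0 0)) := by
  have h1 : ∀ β c, pairK q₁ q₂ z (boxPoint q₁ q₂ u β c) = crossRatio (linF q₁ q₂ (u β) z) c := by
    intro β c
    simp only [pairK, crossRatio, boxPoint, linF]
    congr 1 <;> ring
  have h2 : ∀ β c, pairK q₁ q₂ (boxPoint q₁ q₂ u β c) z =
      crossRatio (linF q₁ q₂ (u β) (q₁ * q₂ * z)) c := by
    intro β c
    simp only [pairK, crossRatio, boxPoint, linF]
    rw [← mul_div_mul_left _ _ (mul_ne_zero hq₁ hq₂)]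
    congr 1 <;> ring
  simp only [oneBody, framing, h1, h2, mul_assoc, ← Finset.prod_mul_distrib]
  congr 1
  refine Finset.prod_congr rfl fun β _ => ?_
  simp only [linF, pow_zero, mul_one, Finset.prod_mul_distrib]
  simp only [div_eq_mul_inv, mul_inv]
  ring

theorem prod_crossRatio_div_eq_rimRatio {B : YoungDiagram} {i D : ℕ} {F : ℕ → ℕ → ℂ}
    (hF : ∀ a ≤ D, ∀ b ≤ D, F a b ≠ 0) (hB : B.card ≤ D) (hi : i ≤ D) :
    (∏ c ∈ B.cells, crossRatio F c) / F 0 0 = rimRatio B i F :=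
  prod_crossRatio_div hF hB hi

/-- After telescoping, the poles in z are addable boxes; those outside the disc and all those in
q₁q₂z are absorbed in `regPart`. Both sides may differ where a cancelled factor vanishes, hence the
exclusion of `badSet`. -/
theorem oneBody_eq_poleFun (hr : 1 ≤ r) (hq₁ : q₁ ≠ 0) (hq₂ : q₂ ≠ 0)
    {Y : Fin r → YoungDiagram} {D : ℕ} (hY : ∀ β, (Y β).card ≤ D) (R : ℝ) {z : ℂ}
    (hz : z ∉ badSet q₁ q₂ u D) :
    oneBody q₁ q₂ u p Y z =
      poleFun ((tupleCorners Y).filter fun b => ‖pt q₁ q₂ u b‖ < R) (pt q₁ q₂ u)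
        (regPart q₁ q₂ u p Y R) z := by
  have hz' : ∀ β, ∀ a ≤ D, ∀ b ≤ D, linF q₁ q₂ (u β) z a b ≠ 0 := fun β a ha b hb h =>
    hz ⟨β, a, ha, b, hb, Or.inl h⟩
  have hz'' : ∀ β, ∀ a ≤ D, ∀ b ≤ D, linF q₁ q₂ (u β) (q₁ * q₂ * z) a b ≠ 0 :=
    fun β a ha b hb h => hz ⟨β, a, ha, b, hb, Or.inr h⟩
  -- Each component contributes one factor z; one of them becomes the zero at the origin built into
  -- `poleFun`, so at least one component is needed.
  have hpow : z ^ r = z * z ^ (r - 1) := by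
    rw [← pow_succ', Nat.sub_add_cancel hr]
  rw [oneBody_eq_prod_crossRatio hq₁ hq₂]
  simp only [prod_crossRatio_div_eq_corners (hz' _) (hY _),
    prod_crossRatio_div_eq_corners (hz'' _) (hY _)]
  simp only [Finset.prod_mul_distrib, Finset.prod_div_distrib, Finset.prod_const,
    Finset.card_univ, Fintype.card_fin]
  have e1 : ∏ β, ∏ c ∈ corners (Y β), linF q₁ q₂ (u β) z c.1 c.2 =
      ∏ b ∈ tupleCorners Y, (z - pt q₁ q₂ u b) := by
    rw [prod_tupleCorners]; rfl
  have e2 : ∏ β, ∏ c ∈ corners (Y β), linF q₁ q₂ (u β) (q₁ * q₂ * z) c.1 c.2 =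
      ∏ b ∈ tupleCorners Y, (q₁ * q₂ * z - pt q₁ q₂ u b) := by
    rw [prod_tupleCorners]; rfl
  rw [e1, e2, hpow, poleFun, regPart, ← Finset.prod_filter_mul_prod_filter_not (tupleCorners Y)
    (fun b => ‖pt q₁ q₂ u b‖ < R) (fun b => z - pt q₁ q₂ u b)]
  simp only [div_eq_mul_inv, mul_inv]
  ring

theorem differentiable_linF (v k : ℂ) (a b : ℕ) :
    Differentiable ℂ fun z => linF q₁ q₂ v (k * z) a b := by
  unfold linF
  fun_prop

theorem differentiable_innerNum (B : YoungDiagram) (v k : ℂ) :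
    Differentiable ℂ fun z => innerNum B (linF q₁ q₂ v (k * z)) := by
  unfold innerNum
  exact Differentiable.fun_finsetProd fun a _ => differentiable_linF v k _ _

theorem differentiableOn_regPart {Y : Fin r → YoungDiagram} {R : ℝ}
    (h1 : ∀ b ∈ tupleCorners Y, ‖pt q₁ q₂ u b‖ ≠ R)
    (h2 : ∀ b ∈ tupleCorners Y, ‖q₁ * q₂‖ * R < ‖pt q₁ q₂ u b‖) :
    DifferentiableOn ℂ (regPart q₁ q₂ u p Y R) (Metric.closedBall 0 R) := by
  intro z hz
  rw [mem_closedBall_zero_iff] at hz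
  refine DifferentiableAt.differentiableWithinAt ?_
  have d1 : ∀ β, DifferentiableAt ℂ (fun z => innerNum (Y β) (linF q₁ q₂ (u β) z)) z := by
    intro β
    simpa using (differentiable_innerNum (q₁ := q₁) (q₂ := q₂) (Y β) (u β) 1) z
  have d2 : ∀ β, DifferentiableAt ℂ
      (fun z => innerNum (Y β) (linF q₁ q₂ (u β) (q₁ * q₂ * z))) z := fun β =>
    differentiable_innerNum (Y β) (u β) (q₁ * q₂) z
  unfold regPart
  refine DifferentiableAt.mul (DifferentiableAt.mul (DifferentiableAt.mul (DifferentiableAt.mul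
    (DifferentiableAt.mul (by fun_prop) (DifferentiableAt.fun_finsetProd fun β _ => d1 β)) ?_)
    (by fun_prop)) (DifferentiableAt.fun_finsetProd fun β _ => d2 β)) ?_
  · refine DifferentiableAt.fun_inv (by fun_prop) (Finset.prod_ne_zero_iff.2 fun b hb h => ?_)
    rw [Finset.mem_filter] at hb
    rw [sub_eq_zero.1 h] at hz
    exact h1 b hb.1 (le_antisymm hz (not_lt.1 hb.2))
  · refine DifferentiableAt.fun_inv (by fun_prop) (Finset.prod_ne_zero_iff.2 fun b hb h => ?_)
    have := h2 b hb
    rw [← sub_eq_zero.1 h, norm_mul (q₁ * q₂) z] at this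
    exact this.not_ge (mul_le_mul_of_nonneg_left hz (norm_nonneg _))

theorem eventually_notMem_of_finite {A : Set ℂ} (hA : A.Finite) (z₀ : ℂ) :
    ∀ᶠ z in 𝓝[≠] z₀, z ∉ A := by
  have h : (A \ {z₀})ᶜ ∈ 𝓝 z₀ :=
    (hA.subset Set.sdiff_subset).isClosed.isOpen_compl.mem_nhds (by simp)
  filter_upwards [mem_nhdsWithin_of_mem_nhds h, self_mem_nhdsWithin] with z h1 h2 h3
  exact h1 ⟨h3, h2⟩

theorem tendsto_poleFun {ι : Type*} [DecidableEq ι] {S : Finset ι} {χ : ι → ℂ} {h : ℂ → ℂ}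
    {c : ι} (hc : c ∈ S) (h0 : χ c ≠ 0) (hχ : Set.InjOn χ S) (hh : ContinuousAt h (χ c)) :
    Tendsto (fun z => (z - χ c) / z * poleFun S χ h z) (𝓝[≠] (χ c)) (𝓝 (poleRes S χ h c)) := by
  have hcont : ContinuousAt (fun z => h z / ∏ c' ∈ S.erase c, (z - χ c')) (χ c) := by
    refine ContinuousAt.div hh (by fun_prop) (Finset.prod_ne_zero_iff.2 fun c' hc' h1 => ?_)
    rw [Finset.mem_erase] at hc'
    exact hc'.1 (hχ hc'.2 hc (sub_eq_zero.1 h1).symm)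
  refine (hcont.tendsto.mono_left nhdsWithin_le_nhds).congr' ?_
  have h0' : ∀ᶠ z in 𝓝[≠] (χ c), z ≠ 0 :=
    (isOpen_ne.mem_nhds h0 : {z : ℂ | z ≠ 0} ∈ 𝓝 (χ c)) |> mem_nhdsWithin_of_mem_nhds
  filter_upwards [h0', self_mem_nhdsWithin] with z hz hzc
  have hne : z - χ c ≠ 0 := sub_ne_zero.2 hzc
  rw [poleFun, ← Finset.mul_prod_erase S _ hc]
  generalize ∏ c' ∈ S.erase c, (z - χ c') = P
  field_simp

theorem rimDen_ne_zero {B : YoungDiagram} {i : ℕ} {F : ℕ → ℕ → ℂ}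
    (h1 : ∀ a < i, F a (B.rowLen a) ≠ 0) (h2 : ∀ b < B.rowLen i, F (B.colLen b) b ≠ 0) :
    rimDen B i F ≠ 0 :=
  mul_ne_zero (Finset.prod_ne_zero_iff.2 fun a ha => h1 a (Finset.mem_range.1 ha))
    (Finset.prod_ne_zero_iff.2 fun b hb => h2 b (Finset.mem_range.1 hb))

theorem continuous_linF (v k : ℂ) (a b : ℕ) : Continuous fun z => linF q₁ q₂ v (k * z) a b :=
  (differentiable_linF v k a b).continuous

theorem continuous_rimNum (B : YoungDiagram) (i : ℕ) (v k : ℂ) :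
    Continuous fun z => rimNum B i (linF q₁ q₂ v (k * z)) := by
  unfold rimNum
  exact Continuous.mul (continuous_finsetProd _ fun _ _ => continuous_linF _ _ _ _)
    (continuous_finsetProd _ fun _ _ => continuous_linF _ _ _ _)

theorem continuous_rimDen (B : YoungDiagram) (i : ℕ) (v k : ℂ) :
    Continuous fun z => rimDen B i (linF q₁ q₂ v (k * z)) := by
  unfold rimDen
  exact Continuous.mul (continuous_finsetProd _ fun _ _ => continuous_linF _ _ _ _)
    (continuous_finsetProd _ fun _ _ => continuous_linF _ _ _ _)

theorem continuousAt_rimRatio {B : YoungDiagram} {i : ℕ} {v k z₀ : ℂ}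
    (h : linF q₁ q₂ v (k * z₀) i (B.rowLen i) ≠ 0)
    (h' : rimDen B i (linF q₁ q₂ v (k * z₀)) ≠ 0) :
    ContinuousAt (fun z => rimRatio B i (linF q₁ q₂ v (k * z))) z₀ := by
  unfold rimRatio
  exact ContinuousAt.div (continuous_rimNum B i v k).continuousAt
    ((continuous_linF v k _ _).mul (continuous_rimDen B i v k)).continuousAt (mul_ne_zero h h')

/-- The positions of all boxes are distinct. -/
theorem linF_pt_ne_zero (hinj : Function.Injective (pt q₁ q₂ u)) {b : Fin r × (ℕ × ℕ)}
    {β : Fin r} {a a' : ℕ} (h : b ≠ (β, (a, a'))) : linF q₁ q₂ (u β) (pt q₁ q₂ u b) a a' ≠ 0 :=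
  sub_ne_zero.2 fun h' => h (hinj h')

theorem mul_pt (b : Fin r × (ℕ × ℕ)) :
    q₁ * q₂ * pt q₁ q₂ u b = pt q₁ q₂ u (b.1, (b.2.1 + 1, b.2.2 + 1)) := by
  simp only [pt, boxPoint]
  ring

theorem linF_pt_ne_zero_of_ne (hinj : Function.Injective (pt q₁ q₂ u))
    {b : Fin r × (ℕ × ℕ)} {β : Fin r} (h : β ≠ b.1) (a a' : ℕ) :
    linF q₁ q₂ (u β) (pt q₁ q₂ u b) a a' ≠ 0 ∧
      linF q₁ q₂ (u β) (q₁ * q₂ * pt q₁ q₂ u b) a a' ≠ 0 := by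
  rw [mul_pt]
  exact ⟨linF_pt_ne_zero hinj fun h' => h (by rw [h']),
    linF_pt_ne_zero hinj fun h' => h (Prod.ext_iff.1 h').1.symm⟩

theorem rimDen_self_ne_zero (hinj : Function.Injective (pt q₁ q₂ u))
    {Y : Fin r → YoungDiagram} {b : Fin r × (ℕ × ℕ)}
    (hb : IsCorner (Y b.1) b.2) : rimDen (Y b.1) b.2.1 (linF q₁ q₂ (u b.1) (pt q₁ q₂ u b)) ≠ 0 := by
  obtain ⟨α, i, j⟩ := b
  have h1 := hb.1
  simp only at h1 ⊢
  refine rimDen_ne_zero (fun a ha => linF_pt_ne_zero hinj ?_)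
    (fun b hb => linF_pt_ne_zero hinj ?_) <;> simp only [ne_eq, Prod.mk.injEq] <;> omega

theorem rimDen_self_shift_ne_zero (hinj : Function.Injective (pt q₁ q₂ u))
    {Y : Fin r → YoungDiagram} {b : Fin r × (ℕ × ℕ)}
    (hb : IsCorner (Y b.1) b.2) :
    rimDen (Y b.1) b.2.1 (linF q₁ q₂ (u b.1) (q₁ * q₂ * pt q₁ q₂ u b)) ≠ 0 := by
  rw [mul_pt]
  obtain ⟨α, i, j⟩ := b
  have h1 := hb.1
  simp only at h1 ⊢
  refine rimDen_ne_zero (fun a ha => linF_pt_ne_zero hinj ?_)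
    (fun b hb => linF_pt_ne_zero hinj ?_) <;> simp only [ne_eq, Prod.mk.injEq] <;> omega

/-- Telescoping split at the row of `b` exhibits the factor `z - pt q₁ q₂ u b` once in the
denominator. Everything else is continuous there because distinct boxes have distinct positions. -/
theorem tendsto_oneBody (hinj : Function.Injective (pt q₁ q₂ u))
    {Y : Fin r → YoungDiagram} {b : Fin r × (ℕ × ℕ)}
    (hb : IsCorner (Y b.1) b.2) (hq₁ : q₁ ≠ 0) (hq₂ : q₂ ≠ 0) (h0 : pt q₁ q₂ u b ≠ 0) :
    Tendsto (fun z => (z - pt q₁ q₂ u b) / z * oneBody q₁ q₂ u p Y z) (𝓝[≠] (pt q₁ q₂ u b))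
      (𝓝 ((∏ m, (pt q₁ q₂ u b - p m)) * resFun q₁ q₂ u Y b (pt q₁ q₂ u b))) := by
  have hj : (Y b.1).rowLen b.2.1 = b.2.2 := hb.1
  have hcont : ContinuousAt (fun z => (∏ m, (z - p m)) * resFun q₁ q₂ u Y b z)
      (pt q₁ q₂ u b) := by
    have hlin : linF q₁ q₂ (u b.1) (q₁ * q₂ * pt q₁ q₂ u b) b.2.1 ((Y b.1).rowLen b.2.1) ≠ 0 := by
      rw [mul_pt]
      refine linF_pt_ne_zero hinj ?_
      simp [Prod.ext_iff]
    refine ContinuousAt.mul (by fun_prop) (ContinuousAt.mul (ContinuousAt.mul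
      (ContinuousAt.div ?_ ?_ (rimDen_self_ne_zero hinj hb)) (ContinuousAt.mul continuousAt_const
        (continuousAt_rimRatio hlin (rimDen_self_shift_ne_zero hinj hb)))) ?_)
    · simpa using (continuous_rimNum (q₁ := q₁) (q₂ := q₂) (Y b.1) b.2.1 (u b.1) 1).continuousAt
    · simpa using (continuous_rimDen (q₁ := q₁) (q₂ := q₂) (Y b.1) b.2.1 (u b.1) 1).continuousAt
    · refine tendsto_finsetProd _ fun β hβ => ?_
      have hne := fun a a' => linF_pt_ne_zero_of_ne hinj (Finset.ne_of_mem_erase hβ) a a' (b := b)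
      refine ContinuousAt.mul (ContinuousAt.mul continuousAt_id ?_)
        (ContinuousAt.mul continuousAt_const
          (continuousAt_rimRatio (hne _ _).2 (rimDen_ne_zero (fun _ _ => (hne _ _).2)
            fun _ _ => (hne _ _).2)))
      have := continuousAt_rimRatio (q₁ := q₁) (q₂ := q₂) (B := Y β) (i := b.2.1) (v := u β)
        (k := 1) (z₀ := pt q₁ q₂ u b)
        (by rw [one_mul]; exact (hne _ _).1) (by
          rw [one_mul]
          exact rimDen_ne_zero (fun _ _ => (hne _ _).1) fun _ _ => (hne _ _).1)
      simpa using this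
  refine (hcont.tendsto.mono_left nhdsWithin_le_nhds).congr' ?_
  -- The bound has to cover the splitting row as well, since that row may lie below some of the
  -- other diagrams.
  set D := (∑ β, (Y β).card) + b.2.1 with hD
  have hYD : ∀ β, (Y β).card ≤ D := fun β =>
    (Finset.single_le_sum (f := fun β => (Y β).card) (fun _ _ => Nat.zero_le _)
      (Finset.mem_univ β)).trans (Nat.le_add_right _ _)
  have h0' : ∀ᶠ z in 𝓝[≠] (pt q₁ q₂ u b), z ≠ 0 :=
    (isOpen_ne.mem_nhds h0 : {z : ℂ | z ≠ 0} ∈ 𝓝 (pt q₁ q₂ u b)) |> mem_nhdsWithin_of_mem_nhds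
  filter_upwards [h0', self_mem_nhdsWithin,
    eventually_notMem_of_finite (badSet_finite (u := u) hq₁ hq₂ D) (pt q₁ q₂ u b)] with z hz hzc hbad
  have hz' : ∀ β, ∀ a ≤ D, ∀ b ≤ D, linF q₁ q₂ (u β) z a b ≠ 0 := fun β a ha b hb h =>
    hbad ⟨β, a, ha, b, hb, Or.inl h⟩
  have hz'' : ∀ β, ∀ a ≤ D, ∀ b ≤ D, linF q₁ q₂ (u β) (q₁ * q₂ * z) a b ≠ 0 :=
    fun β a ha b hb h => hbad ⟨β, a, ha, b, hb, Or.inr h⟩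
  rw [oneBody_eq_prod_crossRatio hq₁ hq₂]
  simp only [prod_crossRatio_div_eq_rimRatio (hz' _) (hYD _) (Nat.le_add_left b.2.1 _),
    prod_crossRatio_div_eq_rimRatio (hz'' _) (hYD _) (Nat.le_add_left b.2.1 _)]
  rw [← Finset.mul_prod_erase _ _ (Finset.mem_univ b.1), resFun]
  have hlin : linF q₁ q₂ (u b.1) z b.2.1 ((Y b.1).rowLen b.2.1) = z - pt q₁ q₂ u b := by
    rw [hj]; rfl
  have hne : z - pt q₁ q₂ u b ≠ 0 := sub_ne_zero.2 hzc
  rw [show rimRatio (Y b.1) b.2.1 (linF q₁ q₂ (u b.1) z) =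
    rimNum (Y b.1) b.2.1 (linF q₁ q₂ (u b.1) z) / ((z - pt q₁ q₂ u b) *
      rimDen (Y b.1) b.2.1 (linF q₁ q₂ (u b.1) z)) by rw [rimRatio, hlin]]
  field_simp

end OneBodyFunction

/-! ### The residue as a quotient of denominators -/

section ResidueValue

variable {q₁ q₂ : ℂ} {r s : ℕ} {u : Fin r → ℂ} {p : Fin s → ℂ}

/-- The denominator `∏_{α,β} N_{α,β}` of a tuple. -/
noncomputable def prodN (q₁ q₂ : ℂ) (u : Fin r → ℂ) (Y : Fin r → YoungDiagram) : ℂ :=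
  ∏ α, ∏ β, N q₁ q₂ u Y α β

theorem pt_ne_zero (hq₁ : q₁ ≠ 0) (hq₂ : q₂ ≠ 0) (hu : ∀ α, u α ≠ 0) (b : Fin r × (ℕ × ℕ)) :
    pt q₁ q₂ u b ≠ 0 :=
  mul_ne_zero (mul_ne_zero (hu _) (pow_ne_zero _ hq₁)) (pow_ne_zero _ hq₂)

/-- Evaluated at an added box, the linear factors in z become the factors of `N` affected when the
second diagram grows; `linF_mul_pt_eq` does the same for q₁q₂z and the first diagram. -/
theorem linF_pt_eq (hq₁ : q₁ ≠ 0) (hq₂ : q₂ ≠ 0) (hu : ∀ α, u α ≠ 0) (b : Fin r × (ℕ × ℕ))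
    (β : Fin r) : linF q₁ q₂ (u β) (pt q₁ q₂ u b) =
      fun a a' => pt q₁ q₂ u b * sndFactor q₁ q₂ (u β / u b.1) b.2 a a' := by
  ext a a'
  have := hu b.1
  simp only [linF, pt, boxPoint, sndFactor, zpow_sub₀ hq₁, zpow_sub₀ hq₂, zpow_natCast]
  field_simp

theorem linF_mul_pt_eq (hq₁ : q₁ ≠ 0) (hq₂ : q₂ ≠ 0) (hu : ∀ α, u α ≠ 0)
    (b : Fin r × (ℕ × ℕ)) (β : Fin r) : linF q₁ q₂ (u β) (q₁ * q₂ * pt q₁ q₂ u b) =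
      fun a a' => (-u β * q₁ ^ a * q₂ ^ a') * fstFactor q₁ q₂ (u b.1 / u β) b.2 a a' := by
  ext a a'
  have := hu β
  simp only [linF, pt, boxPoint, fstFactor, zpow_sub₀ hq₁, zpow_sub₀ hq₂, zpow_add₀ hq₁,
    zpow_add₀ hq₂, zpow_natCast, zpow_one]
  field_simp
  ring

theorem rimRatio_linF_pt (hq₁ : q₁ ≠ 0) (hq₂ : q₂ ≠ 0) (hu : ∀ α, u α ≠ 0)
    (b : Fin r × (ℕ × ℕ)) (β : Fin r) (B : YoungDiagram) (i : ℕ) :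
    pt q₁ q₂ u b * rimRatio B i (linF q₁ q₂ (u β) (pt q₁ q₂ u b)) =
      rimRatio B i (sndFactor q₁ q₂ (u β / u b.1) b.2) := by
  have h0 := pt_ne_zero hq₁ hq₂ hu b
  rw [linF_pt_eq hq₁ hq₂ hu, rimRatio_mul (K := fun _ _ => pt q₁ q₂ u b) (fun _ _ => h0)
    fun _ _ => rfl, mul_div_cancel₀ _ h0]

theorem rimRatio_linF_mul_pt (hq₁ : q₁ ≠ 0) (hq₂ : q₂ ≠ 0) (hu : ∀ α, u α ≠ 0)
    (b : Fin r × (ℕ × ℕ)) (β : Fin r) (B : YoungDiagram) (i : ℕ) :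
    -u β * rimRatio B i (linF q₁ q₂ (u β) (q₁ * q₂ * pt q₁ q₂ u b)) =
      rimRatio B i (fstFactor q₁ q₂ (u b.1 / u β) b.2) := by
  have h0 : -u β ≠ 0 := neg_ne_zero.2 (hu β)
  rw [linF_mul_pt_eq hq₁ hq₂ hu, rimRatio_mul (K := fun a a' => -u β * q₁ ^ a * q₂ ^ a')
    (fun _ _ => mul_ne_zero (mul_ne_zero h0 (pow_ne_zero _ hq₁)) (pow_ne_zero _ hq₂))
    fun _ _ => by ring]
  simp only [pow_zero, mul_one]
  rw [mul_div_cancel₀ _ h0]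

theorem sndFactor_ne_zero (hq₁ : q₁ ≠ 0) (hq₂ : q₂ ≠ 0) (hu : ∀ α, u α ≠ 0)
    (hinj : Function.Injective (pt q₁ q₂ u)) {b : Fin r × (ℕ × ℕ)} {β : Fin r} {a a' : ℕ}
    (h : b ≠ (β, (a, a'))) : sndFactor q₁ q₂ (u β / u b.1) b.2 a a' ≠ 0 := by
  have := linF_pt_ne_zero hinj h
  rw [linF_pt_eq hq₁ hq₂ hu] at this
  exact right_ne_zero_of_mul this

theorem fstFactor_ne_zero (hq₁ : q₁ ≠ 0) (hq₂ : q₂ ≠ 0) (hu : ∀ α, u α ≠ 0)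
    (hinj : Function.Injective (pt q₁ q₂ u)) {b : Fin r × (ℕ × ℕ)} {β : Fin r} {a a' : ℕ}
    (h : (b.1, (b.2.1 + 1, b.2.2 + 1)) ≠ (β, (a, a'))) :
    fstFactor q₁ q₂ (u b.1 / u β) b.2 a a' ≠ 0 := by
  have := linF_pt_ne_zero hinj h
  rw [← mul_pt, linF_mul_pt_eq hq₁ hq₂ hu] at this
  exact right_ne_zero_of_mul this

theorem prod_prod_split {ι : Type*} [Fintype ι] [DecidableEq ι] (α : ι) (X : ι → ι → ℂ) :
    ∏ a, ∏ b, X a b = X α α * (∏ b ∈ Finset.univ.erase α, X b α * X α b) *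
      ∏ a ∈ Finset.univ.erase α, ∏ b ∈ Finset.univ.erase α, X a b := by
  rw [← Finset.mul_prod_erase _ _ (Finset.mem_univ α),
    ← Finset.mul_prod_erase Finset.univ (X α) (Finset.mem_univ α)]
  have : ∀ a, ∏ b, X a b = X a α * ∏ b ∈ Finset.univ.erase α, X a b := fun a =>
    (Finset.mul_prod_erase Finset.univ (X a) (Finset.mem_univ α)).symm
  simp only [this, Finset.prod_mul_distrib]
  ring

/-- Only the row and column of index `b.1` in the matrix of `N` change. Off the diagonal the two
end-factor ratios are precisely the two changes. On the diagonal the box is added first to the left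
diagram, then to the right one, and the prefactor accounts for the box meeting itself. -/
theorem resFun_mul_prodN (hq₁ : q₁ ≠ 0) (hq₂ : q₂ ≠ 0) (hq₁' : q₁ ≠ 1) (hq₂' : q₂ ≠ 1)
    (hu : ∀ α, u α ≠ 0)
    (hinj : Function.Injective (pt q₁ q₂ u)) {Y : Fin r → YoungDiagram} {b : Fin r × (ℕ × ℕ)}
    (hb : IsCorner (Y b.1) b.2) :
    (1 - q₁ * q₂) / ((1 - q₁) * (1 - q₂)) * resFun q₁ q₂ u Y b (pt q₁ q₂ u b) *
      prodN q₁ q₂ u (addTuple Y b) = prodN q₁ q₂ u Y := by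
  have hself : addTuple Y b b.1 = addBox (Y b.1) b.2 := Function.update_self _ _ _
  have hother : ∀ β ∈ Finset.univ.erase b.1, addTuple Y b β = Y β := fun β hβ =>
    Function.update_of_ne (Finset.ne_of_mem_erase hβ) _ _
  have cancel : ∀ {x y n d : ℂ}, d ≠ 0 → x * n = y * d → n / d * x = y := by
    intro x y n d hd h
    field_simp
    linear_combination h
  have hfst := fun {β : Fin r} {a a' : ℕ} => fstFactor_ne_zero hq₁ hq₂ hu hinj
    (b := b) (β := β) (a := a) (a' := a')
  have hsnd := fun {β : Fin r} {a a' : ℕ} => sndFactor_ne_zero hq₁ hq₂ hu hinj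
    (b := b) (β := β) (a := a) (a' := a')
  have hcross : ∀ β ∈ Finset.univ.erase b.1,
      ((pt q₁ q₂ u b * rimRatio (Y β) b.2.1 (linF q₁ q₂ (u β) (pt q₁ q₂ u b))) *
        (-u β * rimRatio (Y β) b.2.1 (linF q₁ q₂ (u β) (q₁ * q₂ * pt q₁ q₂ u b)))) *
        (N q₁ q₂ u (addTuple Y b) β b.1 * N q₁ q₂ u (addTuple Y b) b.1 β) =
      N q₁ q₂ u Y β b.1 * N q₁ q₂ u Y b.1 β := by
    intro β hβ
    have hne : b.1 ≠ β := (Finset.ne_of_mem_erase hβ).symm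
    rw [rimRatio_linF_pt hq₁ hq₂ hu, rimRatio_linF_mul_pt hq₁ hq₂ hu]
    simp only [N_eq_pairN, hself, hother β hβ]
    have h1 := cancel (mul_ne_zero (hsnd fun h => hne (by rw [h]))
      (rimDen_ne_zero (fun _ _ => hsnd fun h => hne (by rw [h]))
        fun _ _ => hsnd fun h => hne (by rw [h])))
      (pairN_addBox_right q₁ q₂ (u β / u b.1) hb (Y β))
    have h2 := cancel (mul_ne_zero (hfst fun h => hne (Prod.ext_iff.1 h).1)
      (rimDen_ne_zero (fun _ _ => hfst fun h => hne (Prod.ext_iff.1 h).1)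
        fun _ _ => hfst fun h => hne (Prod.ext_iff.1 h).1))
      (pairN_addBox_left q₁ q₂ (u b.1 / u β) hb (Y β))
    rw [← rimRatio] at h1 h2
    rw [mul_mul_mul_comm, h1, h2]
  have hdiag : (1 - q₁ * q₂) / ((1 - q₁) * (1 - q₂)) *
      ((rimNum (Y b.1) b.2.1 (linF q₁ q₂ (u b.1) (pt q₁ q₂ u b)) /
        rimDen (Y b.1) b.2.1 (linF q₁ q₂ (u b.1) (pt q₁ q₂ u b))) *
      (-u b.1 * rimRatio (Y b.1) b.2.1 (linF q₁ q₂ (u b.1) (q₁ * q₂ * pt q₁ q₂ u b)))) *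
      N q₁ q₂ u (addTuple Y b) b.1 b.1 = N q₁ q₂ u Y b.1 b.1 := by
    have hpt := pt_ne_zero hq₁ hq₂ hu b
    have hd := rimDen_self_ne_zero hinj hb
    have hd' := rimDen_self_shift_ne_zero hinj hb
    rw [rimRatio_linF_mul_pt hq₁ hq₂ hu]
    rw [linF_pt_eq hq₁ hq₂ hu, rimDen_const_mul] at hd
    rw [linF_pt_eq hq₁ hq₂ hu, rimNum_const_mul, rimDen_const_mul,
      mul_div_mul_left _ _ (left_ne_zero_of_mul hd)]
    replace hd := right_ne_zero_of_mul hd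
    simp only [N_eq_pairN, hself]
    have hdf : rimDen (Y b.1) b.2.1 (fstFactor q₁ q₂ (u b.1 / u b.1) b.2) ≠ 0 := by
      intro h0
      apply hd'
      rw [linF_mul_pt_eq hq₁ hq₂ hu]
      simp only [rimDen, Finset.prod_mul_distrib] at h0 ⊢
      rcases mul_eq_zero.1 h0 with h | h <;> simp [h]
    have hj : (Y b.1).rowLen b.2.1 = b.2.2 := hb.1
    have h1 := cancel (mul_ne_zero (hfst (by rw [hj]; simp [Prod.ext_iff])) hdf)
      (pairN_addBox_left q₁ q₂ (u b.1 / u b.1) hb (Y b.1))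
    rw [← rimRatio] at h1
    -- The left diagram already contains the new box, which brings in three extra factors: 1 - q₁q₂,
    -- 1 - q₁ and 1 - q₂.
    have h2 := pairN_addBox_right q₁ q₂ (u b.1 / u b.1) hb (addBox (Y b.1) b.2)
    rw [rimNum_addBox hb, rimDen_addBox hb, rowLen_addBox hb, if_pos rfl] at h2
    have e1 : sndFactor q₁ q₂ (u b.1 / u b.1) b.2 (b.2.1 + 1) (b.2.2 + 1) = 1 - q₁ * q₂ := by
      simp [sndFactor, div_self (hu b.1)]
    have e2 : sndFactor q₁ q₂ (u b.1 / u b.1) b.2 b.2.1 (b.2.2 + 1) = 1 - q₂ := by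
      simp [sndFactor, div_self (hu b.1)]
    have e3 : sndFactor q₁ q₂ (u b.1 / u b.1) b.2 (b.2.1 + 1) b.2.2 = 1 - q₁ := by
      simp [sndFactor, div_self (hu b.1)]
    rw [e1, e2, e3] at h2
    have hq1 : 1 - q₁ ≠ 0 := sub_ne_zero.2 hq₁'.symm
    have hq2 : 1 - q₂ ≠ 0 := sub_ne_zero.2 hq₂'.symm
    rw [← h1]
    have h3 : (1 - q₁ * q₂) / ((1 - q₁) * (1 - q₂)) *
        (rimNum (Y b.1) b.2.1 (sndFactor q₁ q₂ (u b.1 / u b.1) b.2) /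
          rimDen (Y b.1) b.2.1 (sndFactor q₁ q₂ (u b.1 / u b.1) b.2)) *
        pairN q₁ q₂ (u b.1 / u b.1) (addBox (Y b.1) b.2) (addBox (Y b.1) b.2) =
        pairN q₁ q₂ (u b.1 / u b.1) (addBox (Y b.1) b.2) (Y b.1) := by
      field_simp
      linear_combination h2
    rw [← h3]
    ring
  have hrest : ∏ a ∈ Finset.univ.erase b.1, ∏ c ∈ Finset.univ.erase b.1,
      N q₁ q₂ u (addTuple Y b) a c =
      ∏ a ∈ Finset.univ.erase b.1, ∏ c ∈ Finset.univ.erase b.1, N q₁ q₂ u Y a c :=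
    Finset.prod_congr rfl fun a ha => Finset.prod_congr rfl fun c hc => by
      rw [N_eq_pairN, N_eq_pairN, hother a ha, hother c hc]
  have hprod := Finset.prod_congr rfl hcross
  rw [Finset.prod_mul_distrib] at hprod
  rw [prodN, prodN, prod_prod_split b.1, prod_prod_split b.1 (N q₁ q₂ u Y), ← hdiag, hrest,
    ← hprod, resFun]
  simp only [mul_assoc]
  ring

end ResidueValue

/-! ### Removing a maximal box -/

section RemoveBox

open Classical in
/-- Removes the box `c` from `A`, if the result is a Young diagram. -/
noncomputable def removeBox (A : YoungDiagram) (c : ℕ × ℕ) : YoungDiagram :=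
  if h : IsLowerSet ((A.cells.erase c : Finset (ℕ × ℕ)) : Set (ℕ × ℕ)) then ⟨A.cells.erase c, h⟩
  else A

variable {A : YoungDiagram} {c : ℕ × ℕ}

theorem cells_removeBox (hmax : ∀ d ∈ A, c ≤ d → d = c) :
    (removeBox A c).cells = A.cells.erase c := by
  have hl : IsLowerSet ((A.cells.erase c : Finset (ℕ × ℕ)) : Set (ℕ × ℕ)) := by
    intro a b hab ha
    simp only [Finset.coe_erase, Set.mem_sdiff, Finset.mem_coe, Set.mem_singleton_iff] at ha ⊢
    refine ⟨A.isLowerSet hab ha.1, ?_⟩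
    rintro rfl
    exact ha.2 (hmax a ha.1 hab)
  rw [removeBox, dif_pos hl]

theorem mem_removeBox (hmax : ∀ d ∈ A, c ≤ d → d = c) {d : ℕ × ℕ} :
    d ∈ removeBox A c ↔ d ≠ c ∧ d ∈ A := by
  rw [← YoungDiagram.mem_cells, cells_removeBox hmax, Finset.mem_erase, YoungDiagram.mem_cells]

theorem isCorner_removeBox (hc : c ∈ A) (hmax : ∀ d ∈ A, c ≤ d → d = c) :
    IsCorner (removeBox A c) c := by
  obtain ⟨i, j⟩ := c
  constructor
  · refine eq_of_forall_lt_iff fun b => ?_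
    rw [← YoungDiagram.mem_iff_lt_rowLen, mem_removeBox hmax]
    constructor
    · rintro ⟨h1, h2⟩
      by_contra h
      exact h1 (hmax _ h2 ⟨le_rfl, not_lt.1 h⟩)
    · intro h
      exact ⟨fun h' => h.ne (Prod.ext_iff.1 h').2, A.up_left_mem le_rfl h.le hc⟩
  · refine eq_of_forall_lt_iff fun a => ?_
    rw [← YoungDiagram.mem_iff_lt_colLen, mem_removeBox hmax]
    constructor
    · rintro ⟨h1, h2⟩
      by_contra h
      exact h1 (hmax _ h2 ⟨not_lt.1 h, le_rfl⟩)
    · intro h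
      exact ⟨fun h' => h.ne (Prod.ext_iff.1 h').1, A.up_left_mem h.le le_rfl hc⟩

theorem addBox_removeBox (hc : c ∈ A) (hmax : ∀ d ∈ A, c ≤ d → d = c) :
    addBox (removeBox A c) c = A := by
  refine YoungDiagram.ext ?_
  rw [cells_addBox (isCorner_removeBox hc hmax), cells_removeBox hmax, Finset.insert_erase]
  exact hc

end RemoveBox

/-! ### Building tuples by decreasing modulus -/

section Boxes

variable {q₁ q₂ : ℂ} {r s : ℕ} {u : Fin r → ℂ} {p : Fin s → ℂ} {ρ : ℝ}

/-- All boxes of a tuple. -/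
def boxes (Y : Fin r → YoungDiagram) : Finset (Fin r × (ℕ × ℕ)) :=
  Finset.univ.biUnion fun α => (Y α).cells.image (Prod.mk α)

theorem mem_boxes {Y : Fin r → YoungDiagram} {b : Fin r × (ℕ × ℕ)} :
    b ∈ boxes Y ↔ b.2 ∈ Y b.1 := by
  obtain ⟨α, c⟩ := b
  simp [boxes]

theorem boxes_addTuple {Y : Fin r → YoungDiagram} {b : Fin r × (ℕ × ℕ)}
    (hb : IsCorner (Y b.1) b.2) : boxes (addTuple Y b) = insert b (boxes Y) := by
  ext ⟨β, d⟩
  rw [Finset.mem_insert, mem_boxes, mem_boxes, addTuple]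
  simp only
  rcases eq_or_ne β b.1 with rfl | h
  · rw [Function.update_self, mem_addBox hb]
    simp [Prod.ext_iff]
  · rw [Function.update_of_ne h]
    simp [Prod.ext_iff, h]

variable (q₁ q₂ u ρ) in
/-- The smallest modulus of a box, and at most `ρ`. -/
noncomputable def rad (Y : Fin r → YoungDiagram) : ℝ :=
  (boxes Y).fold min ρ fun b => ‖pt q₁ q₂ u b‖

theorem lt_rad {Y : Fin r → YoungDiagram} {x : ℝ} :
    x < rad q₁ q₂ u ρ Y ↔ x < ρ ∧ ∀ b ∈ boxes Y, x < ‖pt q₁ q₂ u b‖ :=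
  Finset.lt_fold_min x

theorem le_rad {Y : Fin r → YoungDiagram} {x : ℝ} :
    x ≤ rad q₁ q₂ u ρ Y ↔ x ≤ ρ ∧ ∀ b ∈ boxes Y, x ≤ ‖pt q₁ q₂ u b‖ :=
  Finset.le_fold_min x

theorem rad_bot : rad q₁ q₂ u ρ (fun _ => ⊥) = ρ := by
  have : boxes (fun _ : Fin r => (⊥ : YoungDiagram)) = ∅ := by
    ext b
    simp [mem_boxes]
  rw [rad, this, Finset.fold_empty]

theorem rad_addTuple {Y : Fin r → YoungDiagram} {b : Fin r × (ℕ × ℕ)}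
    (hb : IsCorner (Y b.1) b.2) (hlt : ‖pt q₁ q₂ u b‖ < rad q₁ q₂ u ρ Y) :
    rad q₁ q₂ u ρ (addTuple Y b) = ‖pt q₁ q₂ u b‖ := by
  have hnot : b ∉ boxes Y := fun h => hb.notMem (mem_boxes.1 h)
  rw [rad, boxes_addTuple hb, Finset.fold_insert hnot]
  exact min_eq_left hlt.le

theorem norm_pt (b : Fin r × (ℕ × ℕ)) :
    ‖pt q₁ q₂ u b‖ = ‖u b.1‖ * ‖q₁‖ ^ b.2.1 * ‖q₂‖ ^ b.2.2 := by
  simp [pt, boxPoint]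

theorem norm_pt_anti (hq₁ : ‖q₁‖ < 1) (hq₂ : ‖q₂‖ < 1) (α : Fin r) {c d : ℕ × ℕ} (h : c ≤ d) :
    ‖pt q₁ q₂ u (α, d)‖ ≤ ‖pt q₁ q₂ u (α, c)‖ := by
  rw [norm_pt, norm_pt]
  have h1 := pow_le_pow_of_le_one (norm_nonneg q₁) hq₁.le h.1
  have h2 := pow_le_pow_of_le_one (norm_nonneg q₂) hq₂.le h.2
  simp only
  gcongr

theorem norm_pt_lt (hq₁ : ‖q₁‖ < 1) (hq₂ : ‖q₂‖ < 1) (hρ : ∀ α, ‖u α‖ < ρ)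
    (b : Fin r × (ℕ × ℕ)) : ‖pt q₁ q₂ u b‖ < ρ := by
  have := norm_pt_anti (u := u) hq₁ hq₂ b.1 (c := (0, 0)) (d := b.2) ⟨Nat.zero_le _, Nat.zero_le _⟩
  refine this.trans_lt ?_
  simpa [norm_pt] using hρ b.1

theorem card_addTuple {Y : Fin r → YoungDiagram} {b : Fin r × (ℕ × ℕ)}
    (hb : IsCorner (Y b.1) b.2) : ∑ α, (addTuple Y b α).card = ∑ α, (Y α).card + 1 := by
  rw [← Finset.add_sum_erase _ _ (Finset.mem_univ b.1),
    ← Finset.add_sum_erase Finset.univ (fun α => (Y α).card) (Finset.mem_univ b.1), addTuple,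
    Function.update_self, card_addBox hb, add_right_comm]
  congr 2
  exact Finset.sum_congr rfl fun β hβ => by
    rw [Function.update_of_ne (Finset.ne_of_mem_erase hβ)]

variable (q₁ q₂ u ρ) in
/-- The boxes that can be added to a tuple and have smaller modulus than all its boxes. -/
noncomputable def nextBoxes (Y : Fin r → YoungDiagram) : Finset (Fin r × (ℕ × ℕ)) :=
  (tupleCorners Y).filter fun b => ‖pt q₁ q₂ u b‖ < rad q₁ q₂ u ρ Y

theorem mem_nextBoxes {Y : Fin r → YoungDiagram} {b : Fin r × (ℕ × ℕ)} :
    b ∈ nextBoxes q₁ q₂ u ρ Y ↔ IsCorner (Y b.1) b.2 ∧ ‖pt q₁ q₂ u b‖ < rad q₁ q₂ u ρ Y := by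
  rw [nextBoxes, Finset.mem_filter, mem_tupleCorners]

/-- Every tuple arises once by adding its box of smallest modulus. -/
theorem sum_addTuple (hq₁ : ‖q₁‖ < 1) (hq₂ : ‖q₂‖ < 1) (hρ : ∀ α, ‖u α‖ < ρ)
    (hgen : Function.Injective fun b => ‖pt q₁ q₂ u b‖) (k : ℕ)
    (Ψ : (Fin r → YoungDiagram) → ℂ) :
    ∑ Y ∈ partitionTuples r k, ∑ b ∈ nextBoxes q₁ q₂ u ρ Y, Ψ (addTuple Y b) =
      ∑ Y ∈ partitionTuples r (k + 1), Ψ Y := by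
  rw [Finset.sum_sigma']
  refine Finset.sum_bij (fun x _ => addTuple x.1 x.2) ?_ ?_ ?_ fun _ _ => rfl
  · rintro ⟨Y, b⟩ h
    rw [Finset.mem_sigma, mem_partitionTuples, mem_nextBoxes] at h
    rw [mem_partitionTuples, card_addTuple h.2.1, h.1]
  · rintro ⟨Y, b⟩ h ⟨Y', b'⟩ h' heq
    rw [Finset.mem_sigma, mem_nextBoxes] at h h'
    simp only at h h' heq
    -- If the last boxes differed, each would already be present before the other was added, and so
    -- have the larger modulus.
    have hb : b = b' := by
      by_contra hne
      have hbox := congrArg boxes heq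
      rw [boxes_addTuple h.2.1, boxes_addTuple h'.2.1] at hbox
      have m1 : b' ∈ boxes Y := Finset.mem_of_mem_insert_of_ne
        (hbox ▸ Finset.mem_insert_self b' _) (Ne.symm hne)
      have m2 : b ∈ boxes Y' := Finset.mem_of_mem_insert_of_ne
        (hbox ▸ Finset.mem_insert_self b _) hne
      exact lt_asymm ((lt_rad.1 h.2.2).2 _ m1) ((lt_rad.1 h'.2.2).2 _ m2)
    subst hb
    have hY : Y = Y' := by
      funext β
      have hβ := congrFun heq β
      rcases eq_or_ne β b.1 with rfl | hne
      · simp only [addTuple, Function.update_self] at hβ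
        refine YoungDiagram.ext ?_
        have := congrArg YoungDiagram.cells hβ
        rw [cells_addBox h.2.1, cells_addBox h'.2.1] at this
        rw [← Finset.erase_insert (show b.2 ∉ (Y b.1).cells from h.2.1.notMem), this,
          Finset.erase_insert (show b.2 ∉ (Y' b.1).cells from h'.2.1.notMem)]
      · simpa only [addTuple, Function.update_of_ne hne] using hβ
    rw [hY]
  · intro Y' hY'
    rw [mem_partitionTuples] at hY'
    have hne : (boxes Y').Nonempty := by
      by_contra hemp
      rw [Finset.not_nonempty_iff_eq_empty] at hemp
      have : ∑ α, (Y' α).card = 0 := Finset.sum_eq_zero fun α _ => by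
        refine Finset.card_eq_zero.2 (Finset.eq_empty_of_forall_notMem fun c hc => ?_)
        have : (α, c) ∈ boxes Y' := mem_boxes.2 hc
        simp [hemp] at this
      omega
    obtain ⟨b, hbY, hmin⟩ := Finset.exists_min_image (boxes Y') (fun b => ‖pt q₁ q₂ u b‖) hne
    have hbmem := mem_boxes.1 hbY
    -- Moduli do not increase along rows and columns, so the box of least modulus is maximal in its
    -- diagram and can be removed.
    have hmax : ∀ d ∈ Y' b.1, b.2 ≤ d → d = b.2 := by
      intro d hd hle
      have h1 := hmin (b.1, d) (mem_boxes.2 hd)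
      have h2 := norm_pt_anti (u := u) hq₁ hq₂ b.1 hle
      have h3 : b = (b.1, d) := hgen (le_antisymm h1 h2)
      exact (congrArg Prod.snd h3).symm
    set Y : Fin r → YoungDiagram := Function.update Y' b.1 (removeBox (Y' b.1) b.2) with hY
    have hYb : Y b.1 = removeBox (Y' b.1) b.2 := Function.update_self _ _ _
    have hcor : IsCorner (Y b.1) b.2 := by
      rw [hYb]
      exact isCorner_removeBox hbmem hmax
    have hadd : addTuple Y b = Y' := by
      rw [addTuple, hYb, addBox_removeBox hbmem hmax, hY, Function.update_idem,
        Function.update_eq_self]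
    have hboxes : boxes Y' = insert b (boxes Y) := by rw [← hadd, boxes_addTuple hcor]
    refine ⟨⟨Y, b⟩, ?_, hadd⟩
    rw [Finset.mem_sigma, mem_partitionTuples, mem_nextBoxes]
    refine ⟨?_, hcor, lt_rad.2 ⟨norm_pt_lt hq₁ hq₂ hρ b, fun b' hb' => ?_⟩⟩
    · have := card_addTuple hcor
      rw [hadd, hY'] at this
      simp only
      omega
    · refine lt_of_le_of_ne (hmin b' (hboxes ▸ Finset.mem_insert_of_mem hb')) fun h => ?_
      rw [← hgen h] at hb'
      exact hcor.notMem (mem_boxes.1 hb')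

end Boxes

/-! ### The residue recursion on tuples and the generic formula -/

section Recursion

variable {q₁ q₂ : ℂ} {r s : ℕ} {u : Fin r → ℂ} {p : Fin s → ℂ} {ρ : ℝ}

theorem torusAvg_oneBody_succ (hr : 1 ≤ r) (hq₁0 : q₁ ≠ 0) (hq₂0 : q₂ ≠ 0) (hq₁ : ‖q₁‖ < 1)
    (hq₂ : ‖q₂‖ < 1) (hu : ∀ α, u α ≠ 0) (hρ : ∀ α, ‖u α‖ < ρ) (hρ₁ : ∀ α, ‖q₁‖ * ρ < ‖u α‖)
    (hgen : Function.Injective fun b => ‖pt q₁ q₂ u b‖) (Y : Fin r → YoungDiagram) (m : ℕ) :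
    torusAvg q₁ q₂ (m + 1) (fun θ => oneBody q₁ q₂ u p Y (rad q₁ q₂ u ρ Y * unitPt θ)) =
      (m + 1) * ∑ b ∈ nextBoxes q₁ q₂ u ρ Y,
        ((∏ j, (pt q₁ q₂ u b - p j)) * resFun q₁ q₂ u Y b (pt q₁ q₂ u b)) *
          torusAvg q₁ q₂ m (fun θ => oneBody q₁ q₂ u p (addTuple Y b)
            (rad q₁ q₂ u ρ (addTuple Y b) * unitPt θ)) := by
  have hinj : Function.Injective (pt q₁ q₂ u) := fun a b h => hgen (congrArg norm h)
  have hpt := pt_ne_zero hq₁0 hq₂0 hu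
  set R := rad q₁ q₂ u ρ Y with hRdef
  have hR : 0 < R := lt_rad.2 ⟨(norm_nonneg _).trans_lt (hρ ⟨0, hr⟩),
    fun b _ => norm_pos_iff.2 (hpt b)⟩
  have hRρ : R ≤ ρ := (le_rad.1 le_rfl).1
  have hRb : ∀ b ∈ boxes Y, R ≤ ‖pt q₁ q₂ u b‖ := (le_rad.1 le_rfl).2
  set D := ∑ β, (Y β).card with hD
  have hYD : ∀ β, (Y β).card ≤ D := fun β =>
    Finset.single_le_sum (f := fun β => (Y β).card) (fun _ _ => Nat.zero_le _) (Finset.mem_univ β)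
  have hbad := badSet_finite (u := u) hq₁0 hq₂0 D
  set S := (tupleCorners Y).filter fun b => ‖pt q₁ q₂ u b‖ < R with hS
  have hform := fun z hz => oneBody_eq_poleFun (u := u) (p := p) hr hq₁0 hq₂0 hYD R (z := z) hz
  -- The radius is ρ or the modulus of a box already present; addable boxes lie strictly inside ρ
  -- and differ in modulus from present ones.
  have h1 : ∀ b ∈ tupleCorners Y, ‖pt q₁ q₂ u b‖ ≠ R := by
    intro b hb h
    rw [mem_tupleCorners] at hb
    have hlt : R < R := by
      refine lt_rad.2 ⟨h ▸ norm_pt_lt hq₁ hq₂ hρ b, fun b' hb' => ?_⟩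
      refine lt_of_le_of_ne (hRb b' hb') fun h' => ?_
      rw [← hgen (h.trans h')] at hb'
      exact hb.notMem (mem_boxes.1 hb')
    exact hlt.false
  -- The poles in q₁q₂z stay outside the circle. An addable box is the first box, controlled by ρ,
  -- or q₁ or q₂ times a box already present, whose modulus is at least `R`; the remaining q is a
  -- strict gain.
  have h2 : ∀ b ∈ tupleCorners Y, ‖q₁ * q₂‖ * R < ‖pt q₁ q₂ u b‖ := by
    rintro ⟨α, i, j⟩ hb
    rw [mem_tupleCorners] at hb
    have hn₁ : 0 < ‖q₁‖ := norm_pos_iff.2 hq₁0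
    have hn₂ : 0 < ‖q₂‖ := norm_pos_iff.2 hq₂0
    have hq₁R : ‖q₁‖ * ‖q₂‖ * R < ‖q₁‖ * R :=
      mul_lt_mul_of_pos_right (mul_lt_of_lt_one_right hn₁ hq₂) hR
    have hq₂R : ‖q₁‖ * ‖q₂‖ * R < ‖q₂‖ * R :=
      mul_lt_mul_of_pos_right (mul_lt_of_lt_one_left hn₂ hq₁) hR
    rw [norm_mul]
    rcases j with _ | j
    · rcases i with _ | i
      · refine hq₁R.trans (lt_of_le_of_lt ?_ (by simpa [norm_pt] using hρ₁ α))
        exact mul_le_mul_of_nonneg_left hRρ hn₁.le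
      · have hmem : (α, (i, 0)) ∈ boxes Y := mem_boxes.2
          (hb.mem_of_lt (by simp) (by simp))
        refine hq₁R.trans_le ((mul_le_mul_of_nonneg_left (hRb _ hmem) hn₁.le).trans_eq ?_)
        rw [norm_pt, norm_pt]
        simp only
        ring
    · have hmem : (α, (i, j)) ∈ boxes Y := mem_boxes.2
        (hb.mem_of_lt (by simp) (by simp))
      refine hq₂R.trans_le ((mul_le_mul_of_nonneg_left (hRb _ hmem) hn₂.le).trans_eq ?_)
      rw [norm_pt, norm_pt]
      simp only
      ring
  have hdiff := differentiableOn_regPart (p := p) h1 h2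
  have hSR : ∀ b ∈ S, ‖pt q₁ q₂ u b‖ < R := fun b hb => (Finset.mem_filter.1 hb).2
  rw [torusAvg_congr q₁ q₂ (by exact_mod_cast hR.ne') hbad fun θ hθ => hform _ hθ,
    torusAvg_succ_poleFun hq₁ hq₂ hR (fun b _ => hpt b) hSR hgen.injOn hdiff m]
  congr 1
  refine Finset.sum_congr rfl fun b hb => ?_
  have hb' := mem_nextBoxes.1 hb
  have hcb : ContinuousAt (regPart q₁ q₂ u p Y R) (pt q₁ q₂ u b) :=
    hdiff.continuousOn.continuousAt (Metric.closedBall_mem_nhds_of_mem (by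
      rw [mem_ball_zero_iff]
      exact hSR b hb))
  -- The corner formula and the rim formula describe the same function off a finite set, so their
  -- limits at the pole agree.
  have hres : poleRes S (pt q₁ q₂ u) (regPart q₁ q₂ u p Y R) b =
      (∏ j, (pt q₁ q₂ u b - p j)) * resFun q₁ q₂ u Y b (pt q₁ q₂ u b) := by
    refine tendsto_nhds_unique (tendsto_poleFun hb (hpt b) hinj.injOn hcb)
      ((tendsto_oneBody hinj hb'.1 hq₁0 hq₂0 (hpt b)).congr' ?_)
    filter_upwards [eventually_notMem_of_finite hbad (pt q₁ q₂ u b)] with z hz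
    rw [hform z hz]
  rw [hres, rad_addTuple hb'.1 hb'.2]
  congr 1
  rw [← torusAvg_rotate q₁ q₂ (oneBody q₁ q₂ u p (addTuple Y b)) (pt q₁ q₂ u b)]
  refine torusAvg_congr q₁ q₂ (f := fun z => poleFun S (pt q₁ q₂ u) (regPart q₁ q₂ u p Y R) z *
    (pairK q₁ q₂ z (pt q₁ q₂ u b) * pairK q₁ q₂ (pt q₁ q₂ u b) z)) (hpt b) hbad fun θ hθ => ?_
  rw [oneBody_addTuple hb'.1, hform _ hθ]

theorem numer_addTuple {Y : Fin r → YoungDiagram} {b : Fin r × (ℕ × ℕ)}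
    (hb : IsCorner (Y b.1) b.2) : numer q₁ q₂ u p (addTuple Y b) =
      (∏ j, (pt q₁ q₂ u b - p j)) * numer q₁ q₂ u p Y :=
  prod_addTuple hb fun β c => ∏ m, (boxPoint q₁ q₂ u β c - p m)

theorem partitionTuples_zero : partitionTuples r 0 = {fun _ => ⊥} := by
  ext Y
  rw [mem_partitionTuples, Finset.mem_singleton, Finset.sum_eq_zero_iff]
  constructor
  · intro h
    funext α
    refine YoungDiagram.ext ?_
    rw [YoungDiagram.cells_bot]
    exact Finset.card_eq_zero.1 (h α (Finset.mem_univ α))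
  · rintro rfl α _
    rfl

/-- The contour integral as a sum over fixed points, when the moduli of all boxes are distinct. -/
theorem Z_eq_sum_of_injective (hr : 1 ≤ r) (hq₁0 : q₁ ≠ 0) (hq₂0 : q₂ ≠ 0) (hq₁ : ‖q₁‖ < 1)
    (hq₂ : ‖q₂‖ < 1) (hρ : ∀ α, ‖u α‖ < ρ) (hρ₁ : ∀ α, ‖q₁‖ * ρ < ‖u α‖)
    (hρ₂ : ∀ α, ‖q₂‖ * ρ < ‖u α‖) (hgen : Function.Injective fun b => ‖pt q₁ q₂ u b‖) (n : ℕ) :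
    Z q₁ q₂ ρ n u p = ∑ Y ∈ partitionTuples r n, numer q₁ q₂ u p Y / prodN q₁ q₂ u Y := by
  have hρ0 : 0 < ρ := (norm_nonneg _).trans_lt (hρ ⟨0, hr⟩)
  have hu : ∀ α, u α ≠ 0 := fun α =>
    norm_pos_iff.1 ((mul_nonneg (norm_nonneg _) hρ0.le).trans_lt (hρ₁ α))
  have hinj : Function.Injective (pt q₁ q₂ u) := fun a b h => hgen (congrArg norm h)
  have hq₁1 : q₁ ≠ 1 := by rintro rfl; simp at hq₁
  have hq₂1 : q₂ ≠ 1 := by rintro rfl; simp at hq₂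
  set c₀ := (1 - q₁ * q₂) / ((1 - q₁) * (1 - q₂)) with hc₀
  set L : ℕ → (Fin r → YoungDiagram) → ℂ := fun m Y =>
    torusAvg q₁ q₂ m (fun θ => oneBody q₁ q₂ u p Y (rad q₁ q₂ u ρ Y * unitPt θ)) with hL
  -- The state after `k` residues. The factor `m + 1` of each step lowers the factorial, and
  -- nonvanishing of the denominators is carried along because the residue identity passes it on.
  have key : ∀ k m, k + m = n → (∀ Y ∈ partitionTuples r k, prodN q₁ q₂ u Y ≠ 0) ∧
      Z q₁ q₂ ρ n u p = ∑ Y ∈ partitionTuples r k, numer q₁ q₂ u p Y / prodN q₁ q₂ u Y *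
        (c₀ ^ m / m.factorial * L m Y) := by
    intro k
    induction k with
    | zero =>
      intro m hm
      rw [zero_add] at hm
      subst hm
      rw [partitionTuples_zero]
      have hN : prodN q₁ q₂ u (fun _ => ⊥) = 1 := by simp [prodN, N]
      have hnum : numer q₁ q₂ u p (fun _ => ⊥) = 1 := by simp [numer]
      refine ⟨fun Y hY => ?_, ?_⟩
      · rw [Finset.mem_singleton.1 hY, hN]
        exact one_ne_zero
      · rw [Finset.sum_singleton, hN, hnum, Z, torusIntegral_integrand hq₁ hq₂ p hρ0 hρ hρ₂, hL]
        simp only [oneBody_bot, rad_bot]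
        ring
    | succ k ih =>
      intro m hm
      obtain ⟨hN, hZ⟩ := ih (m + 1) (by omega)
      have hstep : ∀ Y ∈ partitionTuples r k, ∀ b ∈ nextBoxes q₁ q₂ u ρ Y,
          prodN q₁ q₂ u (addTuple Y b) ≠ 0 ∧
          c₀ * resFun q₁ q₂ u Y b (pt q₁ q₂ u b) / prodN q₁ q₂ u Y =
            1 / prodN q₁ q₂ u (addTuple Y b) := by
        intro Y hY b hb
        have h1 := resFun_mul_prodN hq₁0 hq₂0 hq₁1 hq₂1 hu hinj (mem_nextBoxes.1 hb).1
        have h2 : prodN q₁ q₂ u (addTuple Y b) ≠ 0 := by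
          intro h
          rw [h, mul_zero] at h1
          exact hN Y hY h1.symm
        exact ⟨h2, by rw [div_eq_div_iff (hN Y hY) h2, one_mul]; exact h1⟩
      refine ⟨?_, ?_⟩
      · have hsum := sum_addTuple (ρ := ρ) hq₁ hq₂ hρ hgen k
          (fun Y => if prodN q₁ q₂ u Y = 0 then 1 else 0)
        rw [Finset.sum_eq_zero fun Y hY => Finset.sum_eq_zero fun b hb =>
          if_neg (hstep Y hY b hb).1, ← Finset.sum_filter, Finset.sum_const, nsmul_eq_mul, mul_one]
          at hsum
        intro Y hY h
        have hcard := Nat.cast_eq_zero.1 hsum.symm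
        rw [Finset.card_eq_zero] at hcard
        exact Finset.notMem_empty Y (hcard ▸ Finset.mem_filter.2 ⟨hY, h⟩)
      · rw [hZ, ← sum_addTuple (ρ := ρ) hq₁ hq₂ hρ hgen k]
        refine Finset.sum_congr rfl fun Y hY => ?_
        simp only [hL]
        rw [torusAvg_oneBody_succ hr hq₁0 hq₂0 hq₁ hq₂ hu hρ hρ₁ hgen, Finset.mul_sum,
          Finset.mul_sum, Finset.mul_sum]
        refine Finset.sum_congr rfl fun b hb => ?_
        have hb' := mem_nextBoxes.1 hb
        have h1 := (hstep Y hY b hb).2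
        rw [numer_addTuple hb'.1, div_eq_mul_one_div (_ * numer q₁ q₂ u p Y), ← h1, pow_succ,
          Nat.factorial_succ]
        push_cast
        have hm1 : (m : ℂ) + 1 ≠ 0 := Nat.cast_add_one_ne_zero m
        have hmf : (m.factorial : ℂ) ≠ 0 := Nat.cast_ne_zero.2 m.factorial_ne_zero
        have hNY := hN Y hY
        field_simp
  obtain ⟨_, hZ⟩ := key n 0 (by omega)
  rw [hZ]
  refine Finset.sum_congr rfl fun Y _ => ?_
  simp [hL, torusAvg_zero]

end Recursion

/-! ### Continuity of both sides in the parameters -/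

section Continuity

variable {X : Type*} [TopologicalSpace X] {r s : ℕ} {q₁ q₂ : X → ℂ} {u : X → Fin r → ℂ}

/-- The domain of integration is a fixed compact torus, and with ρ fixed no denominator vanishes, so
the integrand is jointly continuous. -/
theorem continuous_Z [FirstCountableTopology X] [LocallyCompactSpace X]
    (hq₁c : Continuous q₁) (hq₂c : Continuous q₂) (huc : Continuous u)
    (hq₁ : ∀ x, ‖q₁ x‖ < 1) (hq₂ : ∀ x, ‖q₂ x‖ < 1) {ρ : ℝ} (hρ0 : 0 < ρ)
    (hρ : ∀ x α, ‖u x α‖ < ρ) (hρ₂ : ∀ x α, ‖q₂ x‖ * ρ < ‖u x α‖) (p : Fin s → ℂ) (n : ℕ) :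
    Continuous fun x => Z (q₁ x) (q₂ x) ρ n (u x) p := by
  have hne : ∀ q : ℂ, ‖q‖ < 1 → 1 - q ≠ 0 := by
    intro q hq h
    rw [← sub_eq_zero.1 h] at hq
    simp at hq
  simp only [Z, fun x => torusIntegral_integrand (hq₁ x) (hq₂ x) p hρ0 (hρ x) (hρ₂ x) n]
  have hu := continuous_unitPt
  have hF : Continuous (Function.uncurry fun (x : X) (w : Fin n → AddCircle (2 * π)) =>
      (∏ j, framing (q₁ x) (q₂ x) (u x) p (ρ * unitPt (w j))) *
        interaction (q₁ x) (q₂ x) (fun j => unitPt (w j))) := by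
    unfold framing interaction pairK Function.uncurry
    refine Continuous.mul (continuous_finsetProd _ fun j _ => Continuous.mul (by fun_prop)
      (continuous_finsetProd _ fun α _ => Continuous.div (by fun_prop) (by fun_prop) fun y => ?_))
      (continuous_finsetProd _ fun j _ => continuous_finsetProd _ fun k _ =>
        Continuous.div (by fun_prop) (by fun_prop) fun y => ?_)
    · exact framing_den_ne_zero (hq₁ y.1) (hρ y.1 α) (hρ₂ y.1 α) (by simp [norm_unitPt, hρ0.le])
    · exact pairK_den_ne_zero (hq₁ y.1) (hq₂ y.1) (unitPt_ne_zero _) (by simp [norm_unitPt])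
  have hint : Continuous fun x => torusAvg (q₁ x) (q₂ x) n
      fun θ => framing (q₁ x) (q₂ x) (u x) p (ρ * unitPt θ) := by
    have h := continuous_parametric_integral_of_continuous (μ := torusMeasure n) hF
      isCompact_univ
    simpa only [torusAvg, Measure.restrict_univ] using h
  refine Continuous.mul (Continuous.mul continuous_const (Continuous.pow ?_ n)) hint
  exact Continuous.div (by fun_prop) (by fun_prop) fun x =>
    mul_ne_zero (hne _ (hq₁ x)) (hne _ (hq₂ x))

theorem continuous_pairN {w : X → ℂ} (hq₁c : Continuous q₁) (hq₂c : Continuous q₂)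
    (hw : Continuous w) (hq₁ : ∀ x, q₁ x ≠ 0) (hq₂ : ∀ x, q₂ x ≠ 0) (A B : YoungDiagram) :
    Continuous fun x => pairN (q₁ x) (q₂ x) (w x) A B := by
  have h : ∀ a b : ℤ, Continuous fun x => 1 - w x * q₁ x ^ a * q₂ x ^ b := fun a b =>
    continuous_const.sub ((hw.mul (hq₁c.zpow₀ a fun x => Or.inl (hq₁ x))).mul
      (hq₂c.zpow₀ b fun x => Or.inl (hq₂ x)))
  exact (continuous_finsetProd _ fun c _ => h _ _).mul (continuous_finsetProd _ fun c _ => h _ _)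

theorem continuous_prodN (hq₁c : Continuous q₁) (hq₂c : Continuous q₂) (huc : Continuous u)
    (hq₁ : ∀ x, q₁ x ≠ 0) (hq₂ : ∀ x, q₂ x ≠ 0) (hu : ∀ x α, u x α ≠ 0)
    (Y : Fin r → YoungDiagram) : Continuous fun x => prodN (q₁ x) (q₂ x) (u x) Y := by
  unfold prodN
  simp only [N_eq_pairN]
  refine continuous_finsetProd _ fun α _ => continuous_finsetProd _ fun β _ =>
    continuous_pairN hq₁c hq₂c (Continuous.div (by fun_prop) (by fun_prop) fun x => hu x β) hq₁ hq₂
      _ _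

end Continuity

/-! ### Removal of the distinct-moduli condition -/

section Perturbation

variable {r s : ℕ}

/-- The logarithm of the modulus of a box of the perturbed parameters, as a polynomial in the
perturbation parameter. -/
noncomputable def logNormPoly (q₁ q₂ : ℂ) (u : Fin r → ℂ) (b : Fin r × (ℕ × ℕ)) :
    Polynomial ℝ :=
  Polynomial.C (Real.log ‖pt q₁ q₂ u b‖) + Polynomial.C (b.2.1 : ℝ) * Polynomial.X +
    Polynomial.C (b.2.2 : ℝ) * Polynomial.X ^ 2 + Polynomial.X ^ (3 + (b.1 : ℕ))

/-- The coefficients in degrees 1 and 2 are the coordinates of the box, and the extra monomial of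
degree `3 + α` marks its diagram. -/
theorem logNormPoly_injective (q₁ q₂ : ℂ) (u : Fin r → ℂ) :
    Function.Injective (logNormPoly q₁ q₂ u) := by
  rintro ⟨α, i, j⟩ ⟨β, i', j'⟩ h
  have h1 := congrArg (fun P => P.coeff 1) h
  have h2 := congrArg (fun P => P.coeff 2) h
  have h3 := congrArg (fun P => P.coeff (3 + (α : ℕ))) h
  have e1 : ∀ k : ℕ, 1 ≠ 3 + k := fun k => by omega
  have e2 : ∀ k : ℕ, 2 ≠ 3 + k := fun k => by omega
  have e4 : 3 + (α : ℕ) ≠ 2 := by omega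
  have e5 : 3 + (α : ℕ) ≠ 0 := by omega
  simp only [logNormPoly, Polynomial.coeff_add, Polynomial.coeff_C_mul, Polynomial.coeff_C,
    Polynomial.coeff_X, Polynomial.coeff_X_pow, e1, e2, e4, e5, if_true, if_false,
    one_ne_zero, OfNat.ofNat_ne_zero, OfNat.one_ne_ofNat, mul_zero, mul_one,
    zero_add, add_zero, Nat.cast_inj] at h1 h2 h3
  have h4 : α = β := by
    by_contra hαβ
    rw [if_neg (fun h => hαβ (Fin.ext (by omega)))] at h3
    exact one_ne_zero h3
  subst h1 h2 h4
  rfl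

variable {q₁ q₂ : ℂ} {u : Fin r → ℂ}

theorem eval_logNormPoly (hq₁ : q₁ ≠ 0) (hq₂ : q₂ ≠ 0) (hu : ∀ α, u α ≠ 0)
    (b : Fin r × (ℕ × ℕ)) (t : ℝ) :
    (logNormPoly q₁ q₂ u b).eval t = Real.log ‖pt (q₁ * Real.exp t) (q₂ * Real.exp (t ^ 2))
      (fun α => u α * Real.exp (t ^ (3 + (α : ℕ)))) b‖ := by
  have h : ‖pt (q₁ * Real.exp t) (q₂ * Real.exp (t ^ 2))
      (fun α => u α * Real.exp (t ^ (3 + (α : ℕ)))) b‖ = ‖pt q₁ q₂ u b‖ *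
        Real.exp (b.2.1 * t + b.2.2 * t ^ 2 + t ^ (3 + (b.1 : ℕ))) := by
    rw [norm_pt, norm_pt, Real.exp_add, Real.exp_add, Real.exp_nat_mul, Real.exp_nat_mul]
    simp only [norm_mul, Complex.norm_real, Real.norm_eq_abs, Real.abs_exp]
    ring
  rw [h, Real.log_mul (norm_ne_zero_iff.2 (pt_ne_zero hq₁ hq₂ hu b)) (Real.exp_ne_zero _),
    Real.log_exp]
  simp only [logNormPoly, Polynomial.eval_add, Polynomial.eval_mul, Polynomial.eval_C,
    Polynomial.eval_X, Polynomial.eval_pow]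
  ring

/-- For a dense set of perturbations all boxes have distinct moduli. -/
theorem dense_injective_norm_pt (hq₁ : q₁ ≠ 0) (hq₂ : q₂ ≠ 0) (hu : ∀ α, u α ≠ 0) :
    Dense {t : ℝ | Function.Injective fun b => ‖pt (q₁ * Real.exp t) (q₂ * Real.exp (t ^ 2))
      (fun α => u α * Real.exp (t ^ (3 + (α : ℕ)))) b‖} := by
  -- There are countably many pairs of boxes, and each pair collides for only finitely many `t`.
  have hcount : (⋃ b, ⋃ b', ⋃ _ : b ≠ b',
      {t | (logNormPoly q₁ q₂ u b - logNormPoly q₁ q₂ u b').IsRoot t}).Countable :=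
    Set.countable_iUnion fun b => Set.countable_iUnion fun b' => Set.countable_iUnion fun hb =>
      (Polynomial.finite_setOfPred_isRoot
        (sub_ne_zero.2 fun h => hb (logNormPoly_injective q₁ q₂ u h))).countable
  refine (hcount.dense_compl ℝ).mono fun t ht b b' hbb => ?_
  by_contra hb
  refine ht (Set.mem_iUnion.2 ⟨b, Set.mem_iUnion.2 ⟨b', Set.mem_iUnion.2 ⟨hb, ?_⟩⟩⟩)
  simp only at hbb
  rw [Set.mem_ofPred_eq, Polynomial.IsRoot, Polynomial.eval_sub, eval_logNormPoly hq₁ hq₂ hu,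
    eval_logNormPoly hq₁ hq₂ hu, hbb, sub_self]

/-- The contour integral as a sum over fixed points, when no denominator vanishes. -/
theorem Z_eq_sum {p : Fin s → ℂ} {ρ : ℝ} (hr : 1 ≤ r) (hq₁0 : q₁ ≠ 0) (hq₂0 : q₂ ≠ 0)
    (hq₁ : ‖q₁‖ < 1) (hq₂ : ‖q₂‖ < 1) (hρ : ∀ α, ‖u α‖ < ρ) (hρ₁ : ∀ α, ‖q₁‖ * ρ < ‖u α‖)
    (hρ₂ : ∀ α, ‖q₂‖ * ρ < ‖u α‖) {n : ℕ}
    (hN : ∀ Y ∈ partitionTuples r n, prodN q₁ q₂ u Y ≠ 0) :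
    Z q₁ q₂ ρ n u p = ∑ Y ∈ partitionTuples r n, numer q₁ q₂ u p Y / prodN q₁ q₂ u Y := by
  have hρ0 : 0 < ρ := (norm_nonneg _).trans_lt (hρ ⟨0, hr⟩)
  have hu : ∀ α, u α ≠ 0 := fun α =>
    norm_pos_iff.1 ((mul_nonneg (norm_nonneg _) hρ0.le).trans_lt (hρ₁ α))
  set Q₁ : ℝ → ℂ := fun t => q₁ * Real.exp t with hQ₁
  set Q₂ : ℝ → ℂ := fun t => q₂ * Real.exp (t ^ 2) with hQ₂
  set U : ℝ → Fin r → ℂ := fun t α => u α * Real.exp (t ^ (3 + (α : ℕ))) with hU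
  have hc₁ : Continuous Q₁ := by fun_prop
  have hc₂ : Continuous Q₂ := by fun_prop
  have hcU : Continuous U := by fun_prop
  have h0₁ : Q₁ 0 = q₁ := by simp [hQ₁]
  have h0₂ : Q₂ 0 = q₂ := by simp [hQ₂]
  have h0U : U 0 = u := by
    ext α
    simp [hU]
  have hn₁ : ∀ t, Q₁ t ≠ 0 := fun t => mul_ne_zero hq₁0 (by simp)
  have hn₂ : ∀ t, Q₂ t ≠ 0 := fun t => mul_ne_zero hq₂0 (by simp)
  have hnU : ∀ t α, U t α ≠ 0 := fun t α => mul_ne_zero (hu α) (by simp)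
  -- The conditions are open and hold at `t = 0`, so ρ need not move with the perturbation.
  set V : Set ℝ := {t | ‖Q₁ t‖ < 1} ∩ {t | ‖Q₂ t‖ < 1} ∩ ((⋂ α, {t | ‖U t α‖ < ρ}) ∩
    (⋂ α, {t | ‖Q₁ t‖ * ρ < ‖U t α‖}) ∩ ⋂ α, {t | ‖Q₂ t‖ * ρ < ‖U t α‖}) ∩
    ⋂ Y ∈ partitionTuples r n, {t | prodN (Q₁ t) (Q₂ t) (U t) Y ≠ 0} with hV
  have hcN := fun Y => continuous_prodN hc₁ hc₂ hcU hn₁ hn₂ hnU Y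
  have hVo : IsOpen V := by
    refine ((((isOpen_lt (by fun_prop) (by fun_prop)).inter
      (isOpen_lt (by fun_prop) (by fun_prop))).inter
      (((isOpen_iInter_of_finite fun α => isOpen_lt (by fun_prop) (by fun_prop)).inter
      (isOpen_iInter_of_finite fun α => isOpen_lt (by fun_prop) (by fun_prop))).inter
      (isOpen_iInter_of_finite fun α => isOpen_lt (by fun_prop) (by fun_prop))))).inter
      (isOpen_biInter_finset fun Y _ => isOpen_ne_fun (hcN Y) continuous_const)
  have hVm : ∀ t, t ∈ V → ‖Q₁ t‖ < 1 ∧ ‖Q₂ t‖ < 1 ∧ (∀ α, ‖U t α‖ < ρ) ∧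
      (∀ α, ‖Q₁ t‖ * ρ < ‖U t α‖) ∧ (∀ α, ‖Q₂ t‖ * ρ < ‖U t α‖) ∧
      ∀ Y ∈ partitionTuples r n, prodN (Q₁ t) (Q₂ t) (U t) Y ≠ 0 := by
    intro t ht
    simp only [hV, Set.mem_inter_iff, Set.mem_iInter, Set.mem_ofPred_eq] at ht
    tauto
  have h0 : (0 : ℝ) ∈ V := by
    simp only [hV, Set.mem_inter_iff, Set.mem_iInter, Set.mem_ofPred_eq, h0₁, h0₂, h0U]
    tauto
  have : LocallyCompactSpace V := hVo.locallyCompactSpace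
  have hcv := continuous_subtype_val (p := fun t => t ∈ V)
  have hL : Continuous fun t : V => Z (Q₁ t) (Q₂ t) ρ n (U t) p :=
    continuous_Z (hc₁.comp hcv) (hc₂.comp hcv) (hcU.comp hcv) (fun t => (hVm t t.2).1)
      (fun t => (hVm t t.2).2.1) hρ0 (fun t => (hVm t t.2).2.2.1)
      (fun t => (hVm t t.2).2.2.2.2.1) p n
  have hR : Continuous fun t : V => ∑ Y ∈ partitionTuples r n,
      numer (Q₁ t) (Q₂ t) (U t) p Y / prodN (Q₁ t) (Q₂ t) (U t) Y := by
    refine continuous_finsetSum _ fun Y hY => Continuous.div₀ ?_ ((hcN Y).comp hcv)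
      fun t => (hVm t t.2).2.2.2.2.2 Y hY
    unfold numer boxPoint
    fun_prop
  have hdense := (dense_injective_norm_pt hq₁0 hq₂0 hu).preimage hVo.isOpenMap_subtype_val
  have heq := hL.ext_on hdense hR fun t ht => by
    obtain ⟨h1, h2, h3, h4, h5, _⟩ := hVm t t.2
    exact Z_eq_sum_of_injective hr (hn₁ t) (hn₂ t) h1 h2 h3 h4 h5 ht n
  have := congrFun heq ⟨0, h0⟩
  simpa only [h0₁, h0₂, h0U] using this

end Perturbation

/-! ### Nonvanishing of the denominators -/

section Nonvanishing

variable {q₁ q₂ : ℂ} {r s n : ℕ} {u : Fin r → ℂ}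

theorem card_le_of_mem_partitionTuples {Y : Fin r → YoungDiagram}
    (hY : Y ∈ partitionTuples r n) (α : Fin r) : (Y α).card ≤ n := by
  rw [← mem_partitionTuples.1 hY]
  exact Finset.single_le_sum (f := fun β => (Y β).card) (fun _ _ => Nat.zero_le _)
    (Finset.mem_univ α)

/-- Coordinates of boxes and lengths of rows and columns are bounded by `n`, so all exponents stay
in the grid even for boxes outside the other diagram. -/
theorem pairN_ne_zero_of_grid {w : ℂ}
    (hw : ∀ x ∈ Set.Icc (-(n : ℤ)) n, ∀ y ∈ Set.Icc (-(n : ℤ)) n, w ≠ q₁ ^ x * q₂ ^ y)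
    {A B : YoungDiagram} (hA : A.card ≤ n) (hB : B.card ≤ n) : pairN q₁ q₂ w A B ≠ 0 := by
  have key : ∀ x ∈ Set.Icc (-(n : ℤ)) n, ∀ y ∈ Set.Icc (-(n : ℤ)) n,
      1 - w * q₁ ^ x * q₂ ^ y ≠ 0 := by
    intro x hx y hy h
    refine hw (-x) ⟨by linarith [hx.2], by linarith [hx.1]⟩ (-y)
      ⟨by linarith [hy.2], by linarith [hy.1]⟩ ?_
    rw [zpow_neg, zpow_neg, ← mul_inv]
    refine eq_inv_of_mul_eq_one_left ?_
    rw [← mul_assoc]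
    exact (sub_eq_zero.1 h).symm
  refine mul_ne_zero (Finset.prod_ne_zero_iff.2 fun c hc => key _ ?_ _ ?_)
    (Finset.prod_ne_zero_iff.2 fun c hc => key _ ?_ _ ?_)
  all_goals
    rw [YoungDiagram.mem_cells] at hc
    have h1 := lt_card_of_mem hc
    have h2 := rowLen_le_card A c.1
    have h3 := rowLen_le_card B c.1
    have h4 := colLen_le_card A c.2
    have h5 := colLen_le_card B c.2
    simp only [leg, arm, Set.mem_Icc]
    omega

/-- Here every box lies in the diagram whose arm and leg are taken, so both are natural numbers
below `n`. -/
theorem pairN_one_ne_zero (hq₁ : q₁ ≠ 0) (hq₂ : q₂ ≠ 0)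
    (hq : ∀ x y : ℕ, x < n → y < n → q₁ ^ x ≠ q₂ ^ (y + 1) ∧ q₁ ^ (x + 1) ≠ q₂ ^ y)
    {A : YoungDiagram} (hA : A.card ≤ n) : pairN q₁ q₂ 1 A A ≠ 0 := by
  have key : ∀ c ∈ A, ∃ a l : ℕ, a < n ∧ l < n ∧ arm A c = a ∧ leg A c = l := by
    intro c hc
    have h1 := YoungDiagram.mem_iff_lt_rowLen.1 hc
    have h2 := YoungDiagram.mem_iff_lt_colLen.1 hc
    have h3 := rowLen_le_card A c.1
    have h4 := colLen_le_card A c.2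
    refine ⟨A.rowLen c.1 - (c.2 + 1), A.colLen c.2 - (c.1 + 1), by omega, by omega, ?_, ?_⟩
    · rw [arm]
      omega
    · rw [leg]
      omega
  refine mul_ne_zero (Finset.prod_ne_zero_iff.2 fun c hc h => ?_)
    (Finset.prod_ne_zero_iff.2 fun c hc h => ?_)
  all_goals
    rw [YoungDiagram.mem_cells] at hc
    obtain ⟨a, l, ha, hl, harm, hleg⟩ := key c hc
    rw [harm, hleg, one_mul, zpow_neg] at h
    have h' := (sub_eq_zero.1 h).symm
  · rw [mul_inv_eq_one₀ (zpow_ne_zero _ hq₂)] at h'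
    exact (hq l a hl ha).2 (by exact_mod_cast h')
  · rw [inv_mul_eq_one₀ (zpow_ne_zero _ hq₁)] at h'
    exact (hq l a hl ha).1 (by exact_mod_cast h')

theorem N_ne_zero (hq₁ : q₁ ≠ 0) (hq₂ : q₂ ≠ 0) (hu : ∀ α, u α ≠ 0)
    (hgrid : ∀ α β, α ≠ β → ∀ x ∈ Set.Icc (-(n : ℤ)) n, ∀ y ∈ Set.Icc (-(n : ℤ)) n,
      u α * (u β)⁻¹ ≠ q₁ ^ x * q₂ ^ y)
    (hq : ∀ x y : ℕ, x < n → y < n → q₁ ^ x ≠ q₂ ^ (y + 1) ∧ q₁ ^ (x + 1) ≠ q₂ ^ y)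
    {Y : Fin r → YoungDiagram} (hY : Y ∈ partitionTuples r n) (α β : Fin r) :
    N q₁ q₂ u Y α β ≠ 0 := by
  have hc := card_le_of_mem_partitionTuples hY
  rw [N_eq_pairN]
  rcases eq_or_ne α β with rfl | h
  · rw [div_self (hu α)]
    exact pairN_one_ne_zero hq₁ hq₂ hq (hc α)
  · exact pairN_ne_zero_of_grid (hgrid α β h) (hc α) (hc β)

end Nonvanishing

/-! ### Symmetry under exchange of q₁ and q₂ -/

section Transposition

theorem cells_transpose (A : YoungDiagram) :
    A.transpose.cells = A.cells.map (Equiv.prodComm ℕ ℕ).toEmbedding := by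
  ext c
  simp [YoungDiagram.mem_transpose]

theorem prod_cells_transpose {M : Type*} [CommMonoid M] (A : YoungDiagram) (f : ℕ × ℕ → M) :
    ∏ c ∈ A.transpose.cells, f c = ∏ c ∈ A.cells, f c.swap := by
  rw [cells_transpose, Finset.prod_map]
  rfl

theorem card_transpose (A : YoungDiagram) : A.transpose.card = A.card := by
  rw [YoungDiagram.card, cells_transpose, Finset.card_map]

theorem arm_transpose (A : YoungDiagram) (c : ℕ × ℕ) : arm A.transpose c.swap = leg A c := by
  simp [arm, leg]

theorem leg_transpose (A : YoungDiagram) (c : ℕ × ℕ) : leg A.transpose c.swap = arm A c := by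
  simp [arm, leg]

/-- Transposition of all diagrams of a tuple. -/
def transposeTuple {r : ℕ} (Y : Fin r → YoungDiagram) : Fin r → YoungDiagram :=
  fun α => (Y α).transpose

variable (q₁ q₂ : ℂ) {r s : ℕ} (u : Fin r → ℂ) (p : Fin s → ℂ) (Y : Fin r → YoungDiagram)

theorem transposeTuple_transposeTuple : transposeTuple (transposeTuple Y) = Y := by
  funext α
  exact YoungDiagram.transpose_transpose _

variable {Y} in
theorem transposeTuple_mem_partitionTuples {n : ℕ} (hY : Y ∈ partitionTuples r n) :
    transposeTuple Y ∈ partitionTuples r n := by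
  rw [mem_partitionTuples] at hY ⊢
  simpa only [transposeTuple, card_transpose] using hY

/-- Transposition exchanges arms and legs, which undoes the exchange of q₁ and q₂ up to the shape of
the exponents that distinguishes `M` from `N`. -/
theorem N_swap_transposeTuple (α β : Fin r) :
    N q₂ q₁ u (transposeTuple Y) α β = M q₁ q₂ u Y α β := by
  simp only [N, M, transposeTuple, prod_cells_transpose, arm_transpose, leg_transpose,
    mul_right_comm]

theorem numer_swap_transposeTuple :
    numer q₂ q₁ u p (transposeTuple Y) = numer q₁ q₂ u p Y := by
  simp only [numer, transposeTuple, prod_cells_transpose, boxPoint, Prod.fst_swap, Prod.snd_swap,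
    mul_right_comm]

theorem integrand_swap {n : ℕ} : integrand q₂ q₁ (n := n) u p = integrand q₁ q₂ u p := by
  funext z
  simp only [integrand, weight, mul_comm q₂ q₁]
  congr 2
  refine Finset.prod_congr rfl fun j _ => Finset.prod_congr rfl fun k _ => ?_
  rw [mul_comm (z j - q₂ * z k)]

theorem Z_swap (ρ : ℝ) (n : ℕ) : Z q₂ q₁ ρ n u p = Z q₁ q₂ ρ n u p := by
  rw [Z, Z, integrand_swap, mul_comm q₂, mul_comm (1 - q₂)]

end Transposition

end Nekrasov

/-! ### The theorem -/

theorem mainTheorem2 (r s n : ℕ) (hr : 1 ≤ r) (q₁ q₂ : ℂ)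
    (hq₁0 : q₁ ≠ 0) (hq₂0 : q₂ ≠ 0) (hq₁ : ‖q₁‖ < 1) (hq₂ : ‖q₂‖ < 1)
    (hq : q₁ = (starRingEnd ℂ) q₂ ∨
      ∃ x ∈ Set.Ioo (0 : ℝ) 1, ∃ y ∈ Set.Ioo (0 : ℝ) 1, q₁ = (x : ℂ) ∧ q₂ = (y : ℂ))
    (u : Fin r → ℂ) (p : Fin s → ℂ) (ρ : ℝ)
    (hρ : ∀ α, ‖u α‖ < ρ ∧ ρ < ‖q₁‖⁻¹ * ‖u α‖ ∧ ρ < ‖q₂‖⁻¹ * ‖u α‖)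
    (hgrid : ∀ α β, α ≠ β → ∀ x ∈ Set.Icc (-(n : ℤ)) n, ∀ y ∈ Set.Icc (-(n : ℤ)) n,
      u α * (u β)⁻¹ ≠ q₁ ^ x * q₂ ^ y)
    (hgrid' : ∀ x y : ℕ, x < n → y < n → q₁ ^ x ≠ q₂ ^ (y + 1) ∧ q₁ ^ (x + 1) ≠ q₂ ^ y) :
    TorusIntegrable (Nekrasov.integrand q₁ q₂ u p) (0 : Fin n → ℂ) (fun _ => ρ) ∧
    (∀ Y ∈ Nekrasov.partitionTuples r n, ∀ α β,
      Nekrasov.N q₁ q₂ u Y α β ≠ 0 ∧ Nekrasov.M q₁ q₂ u Y α β ≠ 0) ∧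
    Nekrasov.Z q₁ q₂ ρ n u p =
      ∑ Y ∈ Nekrasov.partitionTuples r n,
        Nekrasov.numer q₁ q₂ u p Y / ∏ α, ∏ β, Nekrasov.N q₁ q₂ u Y α β ∧
    Nekrasov.Z q₁ q₂ ρ n u p =
      ∑ Y ∈ Nekrasov.partitionTuples r n,
        Nekrasov.numer q₁ q₂ u p Y / ∏ α, ∏ β, Nekrasov.M q₁ q₂ u Y α β := by
  have hρu : ∀ α, ‖u α‖ < ρ := fun α => (hρ α).1
  have hρ₁ : ∀ α, ‖q₁‖ * ρ < ‖u α‖ := fun α =>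
    (lt_inv_mul_iff₀ (norm_pos_iff.2 hq₁0)).1 (hρ α).2.1
  have hρ₂ : ∀ α, ‖q₂‖ * ρ < ‖u α‖ := fun α =>
    (lt_inv_mul_iff₀ (norm_pos_iff.2 hq₂0)).1 (hρ α).2.2
  have hρ0 : 0 < ρ := (norm_nonneg _).trans_lt (hρu ⟨0, hr⟩)
  have hu : ∀ α, u α ≠ 0 := fun α =>
    norm_pos_iff.1 ((mul_nonneg (norm_nonneg _) hρ0.le).trans_lt (hρ₁ α))
  have hN : ∀ Y ∈ Nekrasov.partitionTuples r n, ∀ α β, Nekrasov.N q₁ q₂ u Y α β ≠ 0 :=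
    fun Y hY => Nekrasov.N_ne_zero hq₁0 hq₂0 hu hgrid hgrid' hY
  have hN' : ∀ Y ∈ Nekrasov.partitionTuples r n, ∀ α β, Nekrasov.N q₂ q₁ u Y α β ≠ 0 :=
    fun Y hY => Nekrasov.N_ne_zero hq₂0 hq₁0 hu
      (fun α β h x hx y hy => by
        rw [mul_comm (q₂ ^ x)]
        exact hgrid α β h y hy x hx)
      (fun x y hx hy => ⟨(hgrid' y x hy hx).2.symm, (hgrid' y x hy hx).1.symm⟩) hY
  refine ⟨Nekrasov.torusIntegrable_integrand hq₁ hq₂ p hρ0 hρu hρ₂ n, fun Y hY α β =>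
    ⟨hN Y hY α β, ?_⟩, Nekrasov.Z_eq_sum hr hq₁0 hq₂0 hq₁ hq₂ hρu hρ₁ hρ₂ fun Y hY =>
      Finset.prod_ne_zero_iff.2 fun α _ => Finset.prod_ne_zero_iff.2 fun β _ => hN Y hY α β, ?_⟩
  · rw [← Nekrasov.N_swap_transposeTuple]
    exact hN' _ (Nekrasov.transposeTuple_mem_partitionTuples hY) α β
  -- The integral is symmetric in q₁ and q₂, so the formula with `N` is applied to the exchanged
  -- parameters and reindexed by transposition.
  · rw [← Nekrasov.Z_swap, Nekrasov.Z_eq_sum hr hq₂0 hq₁0 hq₂ hq₁ hρu hρ₂ hρ₁ fun Y hY =>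
      Finset.prod_ne_zero_iff.2 fun α _ => Finset.prod_ne_zero_iff.2 fun β _ => hN' Y hY α β]
    refine (Finset.sum_bij' (fun Y _ => Nekrasov.transposeTuple Y)
      (fun Y _ => Nekrasov.transposeTuple Y)
      (fun Y hY => Nekrasov.transposeTuple_mem_partitionTuples hY)
      (fun Y hY => Nekrasov.transposeTuple_mem_partitionTuples hY)
      (fun Y _ => Nekrasov.transposeTuple_transposeTuple Y)
      (fun Y _ => Nekrasov.transposeTuple_transposeTuple Y) fun Y _ => ?_).symm
    simp only [Nekrasov.prodN, Nekrasov.N_swap_transposeTuple, Nekrasov.numer_swap_transposeTuple]
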